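/- Let $\mathcal X,\mathcal Y$ be separable real Hilbert spaces, $\gamma$ a Borel probability measure on $\mathcal X$, $\sigma>0$, and $G_0:\mathcal X\to\mathcal Y$ Borel measurable with $\sup_{x\in\operatorname{supp}\gamma}\|G_0(x)\|_{\mathcal Y}<\infty$. Write $\|G\|_\infty=\sup_{x\in\operatorname{supp}\gamma}\|G(x)\|_{\mathcal Y}$ and $\|G\|_{L^2(\gamma)}^2=\int\|G\|_{\mathcal Y}^2\,d\gamma$. **Model.** For a sample size $n\ge1$ let $x_1,\dots,x_n$ be i.i.d. with law $\gamma$ and $y_i=G_0(x_i)+\sigma\varepsilon_i$, where $\varepsilon_1,\dots,\varepsilon_n$ are independent, independent of $(x_i)_{i\le n}$, and either - (white noise) each $\varepsilon_i$ is a Gaussian white noise process $(\langle\varepsilon_i,f\rangle)_{f\in\mathcal Y}$, i.e. a centred Gaussian process with covariance $\operatorname{Cov}(\langle\varepsilon_i,f\rangle,\langle\varepsilon_i,g\rangle)=\langle f,g\rangle_{\mathcal Y}$, used in its canonical version $\langle\varepsilon_i,f\rangle=\sum_j\langle\psi_j,f\rangle_{\mathcal Y}\langle\varepsilon_i,\psi_j\rangle$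 for an orthonormal basis $(\psi_j)_j$ of $\mathcal Y$; or - (sub-Gaussian noise) each $\varepsilon_i$ is a $\mathcal Y$-valued random vector with $\mathbb E\varepsilon_i=0$ and $\mathbb P(\|\varepsilon_i\|_{\mathcal Y}\ge t)\le 2e^{-t^2/2}$ for all $t\ge0$. Put $\langle y_i,f\rangle=\langle G_0(x_i),f\rangle_{\mathcal Y}+\sigma\langle\varepsilon_i,f\rangle$. For a class $\boldsymbol G$ of measurable maps $\mathcal X\to\mathcal Y$, a measurable empirical risk minimizer (ERM) over $\boldsymbol G$ is a random element $\hat G_n$ of $\boldsymbol G$, measurable for the Borel $\sigma$-algebra of $\|\cdot\|_\infty$, that almost surely minimizes $$I_n(G)=\frac1n\sum_{i=1}^n\bigl(-2\langle y_i,G(x_i)\rangle+\|G(x_i)\|_{\mathcal Y}^2\bigr)\quad\text{over }G\in\boldsymbol G.$$ **Classes.** Let $\boldsymbol G(N)$, $N\in\mathbb N=\{1,2,\dots\}$, be classes of measurable maps $\mathcal X\to\mathcal Y$, each compact with respect to $\|\cdot\|_\infty$, with $\sup_{N}\sup_{G\in\boldsymbol G(N)}\|G-G_0\|_\infty<\infty$.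 Let $H(N,\delta)$ be the logarithm of the minimal number of open $\|\cdot\|_\infty$-balls of radius $\delta$ with centres in $\boldsymbol G(N)$ that cover $\boldsymbol G(N)$. Suppose that for some $\beta>0$ and some $c$ independent of $N$, $$\inf_{G^*\in\boldsymbol G(N)}\|G^*-G_0\|_{L^2(\gamma)}^2\le cN^{-\beta}\qquad\text{for all }N\in\mathbb N.$$ 1. Suppose that for some $0<\alpha<2$, some $c'$ and some $\delta_0\in(0,1)$, $H(N,\delta)\le c'\delta^{-\alpha}$ for all $N\in\mathbb N$ and $0<\delta\le\delta_0$. Then there is $C>0$ such that for all $n\ge1$ and all $N\in\mathbb N$ with $N^{-\beta}\le n^{-2/(2+\alpha)}$, every measurable ERM $\hat G_n$ over $\boldsymbol G(N)$ satisfies $$\mathbb E\bigl[\|\hat G_n-G_0\|_{L^2(\gamma)}^2\bigr]\le C\,n^{-\frac{2}{2+\alpha}}.$$ 2. Suppose that for some $c'$ and some $\delta_0\in(0,1)$, $H(N,\delta)\le c'N\log(\delta^{-1})$ for all $N\in\mathbb N$ and $0<\delta\le\delta_0$. Then for every $\tau>0$ there is $C>0$ such that for all $n\ge1$, with $N=N(n)=\lceil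 n^{1/(\beta+1)}\rceil$, every measurable ERM $\hat G_n$ over $\boldsymbol G(N)$ satisfies $$\mathbb E\bigl[\|\hat G_n-G_0\|_{L^2(\gamma)}^2\bigr]\le C\,n^{-\frac{\beta}{\beta+1}+\tau}.$$ In both parts $C$ does not depend on $n$, on $N$, on the underlying probability space, on the noise, or on the choice of the ERM. -/

import Mathlib

open MeasureTheory ProbabilityTheory Filter Topology
open scoped ENNReal

noncomputable section

/-! ### Sup-norm on the support, covering numbers and metric entropy -/

section Entropy

variable {X Y : Type*} [TopologicalSpace X] [MeasurableSpace X] [PseudoEMetricSpace Y]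

/-- The restriction of `G` to `supp γ`, as an element of the space of functions on `supp γ` with
the uniform (extended) distance `⨆ x ∈ supp γ, edist (F x) (G x)`, i.e. `‖F - G‖_{∞, supp γ}`. -/
def supRestrict (γ : Measure X) (G : X → Y) : UniformFun γ.support Y :=
  UniformFun.ofFun (fun x : γ.support => G x)

/-- The minimal number of open `δ`-balls with centres in `T` needed to cover `T`. -/
def openCoveringNumber {E : Type*} [PseudoEMetricSpace E] (T : Set E) (δ : ℝ) : ℕ∞ :=
  ⨅ (S : Set E) (_ : S ⊆ T) (_ : T ⊆ ⋃ c ∈ S, Metric.eball c (ENNReal.ofReal δ)), S.encard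

/-- Metric entropy: the logarithm of the covering number. -/
def metricEntropy {E : Type*} [PseudoEMetricSpace E] (T : Set E) (δ : ℝ) : EReal :=
  ENNReal.log (openCoveringNumber T δ : ℝ≥0∞)

/-- `H(𝒢, ‖·‖_{∞, supp γ}, δ)`. -/
def supEntropy (γ : Measure X) (𝒢 : Set (X → Y)) (δ : ℝ) : EReal :=
  metricEntropy (supRestrict γ '' 𝒢) δ

end Entropy

/-! ### The regression model -/

section Model

variable {Ω X Y : Type*} [MeasurableSpace Ω]
  [TopologicalSpace X] [MeasurableSpace X]
  [NormedAddCommGroup Y] [InnerProductSpace ℝ Y] [MeasurableSpace Y]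

/-- `‖F - G‖²_{L²(γ)}`, as an extended nonnegative real. -/
def l2DistSq (γ : Measure X) (F G : X → Y) : ℝ≥0∞ :=
  ∫⁻ x, ‖F x - G x‖ₑ ^ 2 ∂γ

/-- The design points `x 0, …, x (n - 1)` are i.i.d. with law `γ`. -/
structure IsIIDDesign (γ : Measure X) (P : Measure Ω) {n : ℕ} (x : Fin n → Ω → X) : Prop where
  measurable : ∀ i, Measurable (x i)
  law : ∀ i, P.map (x i) = γ
  indep : iIndepFun x P

/-- `W` is a Gaussian white noise process indexed by the Hilbert space `Y`: a centred Gaussian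
process with isonormal covariance. -/
structure IsGaussianWhiteNoise (P : Measure Ω) (W : Y → Ω → ℝ) : Prop where
  measurable : ∀ y, Measurable (W y)
  gaussian : IsGaussianProcess W P
  mean_zero : ∀ y, ∫ ω, W y ω ∂P = 0
  covariance : ∀ y y', covariance (W y) (W y') P = inner ℝ y y'

/-- `ψ` is an orthonormal basis of `Y`, enumerated by `ℕ` and possibly padded by zero vectors (so
that finite-dimensional spaces are included). -/
structure IsOrthonormalSequenceBasis (ψ : ℕ → Y) : Prop where
  orthonormal : Orthonormal ℝ (fun j : {j : ℕ // ψ j ≠ 0} => ψ j)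
  dense : (Submodule.span ℝ (Set.range ψ)).topologicalClosure = ⊤

/-- The canonical version `y ↦ ∑ j, ⟨ψ j, y⟩ w (ψ j)` of a white noise path `w : Y → ℝ`, the sum
being the limit of its partial sums. For each fixed `y` it is almost surely equal to `w y`; it is
the version at which random elements `y` of `Y` are evaluated. -/
def whiteNoisePairing (ψ : ℕ → Y) (w : Y → ℝ) (y : Y) : ℝ :=
  limUnder atTop (fun J : ℕ => ∑ j ∈ Finset.range J, inner ℝ (ψ j) y * w (ψ j))

/-- White noise model: `ξ i ω f` stands for `⟨ε_i(ω), f⟩`, where `ε_0, …, ε_(n-1)` are independent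
Gaussian white noise processes which are independent of the design. -/
def IsWhiteNoiseModel (P : Measure Ω) {n : ℕ} (x : Fin n → Ω → X)
    (ξ : Fin n → Ω → Y → ℝ) : Prop :=
  ∃ (ψ : ℕ → Y) (W : Fin n → Y → Ω → ℝ),
    IsOrthonormalSequenceBasis ψ ∧
    (∀ i, IsGaussianWhiteNoise P (W i)) ∧
    iIndepFun (fun i ω y => W i y ω) P ∧
    IndepFun (fun ω i => x i ω) (fun ω i y => W i y ω) P ∧
    ∀ i ω f, ξ i ω f = whiteNoisePairing ψ (fun y => W i y ω) f

/-- `ε` is a sub-Gaussian random vector in `Y` with parameter `η`. -/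
structure IsSubGaussianVector (P : Measure Ω) (ε : Ω → Y) (η : ℝ) : Prop where
  measurable : Measurable ε
  mean_zero : ∫ ω, ε ω ∂P = 0
  tail : ∀ t : ℝ, 0 ≤ t → P.real {ω | t ≤ ‖ε ω‖} ≤ 2 * Real.exp (-t ^ 2 / (2 * η ^ 2))

/-- Sub-Gaussian noise model: `ξ i ω f = ⟨ε_i(ω), f⟩`, where `ε_0, …, ε_(n-1)` are independent
sub-Gaussian vectors with parameter `1` which are independent of the design. -/
def IsSubGaussianNoiseModel (P : Measure Ω) {n : ℕ} (x : Fin n → Ω → X)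
    (ξ : Fin n → Ω → Y → ℝ) : Prop :=
  ∃ ε : Fin n → Ω → Y,
    (∀ i, IsSubGaussianVector P (ε i) 1) ∧
    iIndepFun ε P ∧
    IndepFun (fun ω i => x i ω) (fun ω i => ε i ω) P ∧
    ∀ i ω f, ξ i ω f = inner ℝ (ε i ω) f

/-- The observation `y = G₀(x) + σ ε` as the functional `f ↦ ⟨y, f⟩ = ⟨G₀(x), f⟩ + σ ⟨ε, f⟩`, where
`e f = ⟨ε, f⟩`. -/
def observation (G₀ : X → Y) (σ : ℝ) (x : X) (e : Y → ℝ) : Y → ℝ :=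
  fun f => inner ℝ (G₀ x) f + σ * e f

/-- The empirical risk `I_n(G) = n⁻¹ ∑ i, (-2 ⟨G(x_i), y_i⟩ + ‖G(x_i)‖²)`; an observation is given
by the functional `f ↦ ⟨y_i, f⟩`. -/
def empiricalRisk {n : ℕ} (x : Fin n → X) (y : Fin n → Y → ℝ) (G : X → Y) : ℝ :=
  (1 / (n : ℝ)) * ∑ i, (-2 * y i (G (x i)) + ‖G (x i)‖ ^ 2)

/-- `Ĝ` is a measurable empirical risk minimizer over the class `𝒢`: it is measurable for the Borel
σ-algebra of `‖·‖_{∞, supp γ}`, and almost surely it minimizes the empirical risk over `𝒢`. -/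
structure IsMeasurableERM (γ : Measure X) (G₀ : X → Y) (σ : ℝ) (𝒢 : Set (X → Y))
    (P : Measure Ω) {n : ℕ} (x : Fin n → Ω → X) (ξ : Fin n → Ω → Y → ℝ)
    (Ĝ : Ω → X → Y) : Prop where
  measurable :
    @Measurable Ω (UniformFun γ.support Y) _ (borel _) (fun ω => supRestrict γ (Ĝ ω))
  minimizes : ∀ᵐ ω ∂P, Ĝ ω ∈ 𝒢 ∧ ∀ G ∈ 𝒢,
    empiricalRisk (fun i => x i ω) (fun i => observation G₀ σ (x i ω) (ξ i ω)) (Ĝ ω) ≤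
      empiricalRisk (fun i => x i ω) (fun i => observation G₀ σ (x i ω) (ξ i ω)) G

/-- The mean squared error `𝔼 ‖Ĝ - G₀‖²_{L²(γ)}`. -/
def meanSquaredError (γ : Measure X) (G₀ : X → Y) (P : Measure Ω) (Ĝ : Ω → X → Y) : ℝ≥0∞ :=
  ∫⁻ ω, l2DistSq γ (Ĝ ω) G₀ ∂P

end Model

end

open MeasureTheory ProbabilityTheory Filter Topology
open scoped ENNReal


/-! Let `Q G G'` be the sum over the design points of `‖G - G'‖ ^ 2`, and `M G G'` the sum of the
noise functionals along `G - G'`. Completing the square turns empirical minimality into `Q Ĝ G₀ ≤ Q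
G* G₀ + 2σ M Ĝ G*`. It remains to control `M` uniformly over the class and to pass from `Q` to the
`L²(γ)` error.

Both tasks are handled at one fixed scale δ, without peeling. Write H(δ) for an entropy bound and
let `g 0` be a point of a finite δ-net near `Ĝ`. On the net, `t M - c t² Q` has exponential moment
at most one. So `2σ M (g 0) G*` costs a multiple of H(δ) + O(1), plus a small multiple of `Q` that
is absorbed on the left. In the same way, n times the `L²(γ)` error is bounded by `2 Q` plus a
multiple of H(δ) + O(1). The remainder `M Ĝ (g 0)` is chained through nets of radius δ2⁻ᵏ. Since the
entropy exponent is below 2, the links form a convergent geometric series of order √n · δ · √H(δ) ≤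
(nδ² + H(δ)) / 2. This gives `meanSquaredError_le_of_entropy`: the risk is at most of the order of
the approximation error plus δ² + H(δ)/n. Part 1 balances the last two terms. Part 2 reduces to
polynomial entropy of arbitrarily small exponent through log u⁻¹ ≤ u⁻ᵃ / a.

The noise models enter only through `IsSubGaussianNoise` (exponential moments) and
`IsChainContinuousNoise` (the chain may be followed to its limit). The second property is delicate
for white noise, which is not a continuous functional on `Y`, while `Ĝ` depends on it. There, Doob's
maximal inequality bounds all partial sums of the defining series at once. A union bound over links
and Borel–Cantelli then make convergence along the chain uniform in the truncation level, so the two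
limits may be interchanged. -/

/-! ### Series of independent Gaussian-type random variables -/

section Series

variable {Ω : Type*} [MeasurableSpace Ω] {P : Measure Ω}

/-- Partial products of independent nonnegative variables with means at least one form a
submartingale. -/
theorem submartingale_prod_of_iIndepFun [IsProbabilityMeasure P] {Y : ℕ → Ω → ℝ}
    (hY : ∀ j, Measurable (Y j)) (hind : iIndepFun Y P) (hint : ∀ j, Integrable (Y j) P)
    (hnn : ∀ j ω, 0 ≤ Y j ω) (hone : ∀ j, 1 ≤ ∫ ω, Y j ω ∂P) :
    Submartingale (fun n ω => ∏ j ∈ Finset.range (n + 1), Y j ω)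
      (Filtration.natural Y fun j => (hY j).stronglyMeasurable) P := by
  have hsm := fun j => (hY j).stronglyMeasurable
  have hintp : ∀ n, Integrable (fun ω => ∏ j ∈ Finset.range n, Y j ω) P := by
    intro n
    induction n with
    | zero => simp
    | succ n ih =>
      have := (hind.indepFun_prod_range_succ hY n)
      have h2 := IndepFun.integrable_mul this (by convert ih using 1; ext; simp) (hint n)
      convert h2 using 1
      ext ω
      simp [Finset.prod_range_succ]
  have hadapt : StronglyAdapted (Filtration.natural Y hsm)
      (fun n ω => ∏ j ∈ Finset.range (n + 1), Y j ω) := by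
    intro n
    refine Finset.stronglyMeasurable_fun_prod _ fun j hj => ?_
    exact (Filtration.stronglyAdapted_natural hsm j).mono
      ((Filtration.natural Y hsm).mono (by simpa [Nat.lt_succ_iff] using hj))
  refine submartingale_nat hadapt (fun n => hintp _) fun n => ?_
  have h1 : (fun ω => ∏ j ∈ Finset.range (n + 1 + 1), Y j ω)
      = (fun ω => ∏ j ∈ Finset.range (n + 1), Y j ω) * Y (n + 1) := by
    ext ω; simp [Finset.prod_range_succ _ (n + 1)]
  -- The past product is pulled out of the conditional expectation; the new factor is independent of
  -- the past, so only its mean remains.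
  have h2 := condExp_mul_of_stronglyMeasurable_left (μ := P) (hadapt n)
    (g := Y (n + 1)) (by rw [← h1]; exact hintp _) (hint _)
  have h3 := hind.condExp_natural_ae_eq_of_lt hsm (Nat.lt_succ_self n)
  simp only [h1]
  filter_upwards [h2, h3] with ω h2 h3
  rw [h2, Pi.mul_apply, h3]
  exact le_mul_of_one_le_right (Finset.prod_nonneg fun j _ => hnn j ω) (hone _)

variable [IsProbabilityMeasure P] {X : ℕ → Ω → ℝ} {s : ℕ → ℝ} {V : ℝ}

omit [IsProbabilityMeasure P] in
theorem integrable_exp_of_mgf_eq_exp {Z : Ω → ℝ} {t a : ℝ} (h : mgf Z P t = Real.exp a) :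
    Integrable (fun ω => Real.exp (t * Z ω)) P := by
  by_contra hn
  have : mgf Z P t = 0 := integral_undef hn
  rw [this] at h
  exact (Real.exp_pos a).ne h

/-- Each factor `exp (t * X j)` has mean `exp (t ^ 2 * s j / 2) ≥ 1`. Both the maximal inequality
and the almost sure convergence below rest on this submartingale. -/
theorem submartingale_exp_sum (hX : ∀ j, Measurable (X j)) (hind : iIndepFun X P)
    (hmgf : ∀ j t, mgf (X j) P t = Real.exp (t ^ 2 * s j / 2)) (hs : ∀ j, 0 ≤ s j) (t : ℝ) :
    ∃ ℱ : Filtration ℕ (inferInstance : MeasurableSpace Ω),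
      Submartingale (fun n ω => Real.exp (t * ∑ j ∈ Finset.range (n + 1), X j ω)) ℱ P := by
  have hm : ∀ j, Measurable (fun ω => Real.exp (t * X j ω)) := fun j =>
    ((hX j).const_mul t).exp
  have hI : iIndepFun (fun j ω => Real.exp (t * X j ω)) P :=
    hind.comp (fun _ x => Real.exp (t * x)) (fun _ => by fun_prop)
  have h := submartingale_prod_of_iIndepFun hm hI
    (fun j => integrable_exp_of_mgf_eq_exp (hmgf j t)) (fun _ _ => (Real.exp_pos _).le)
    (fun j => by
      have : mgf (X j) P t = _ := hmgf j t
      rw [mgf] at this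
      rw [this]
      exact Real.one_le_exp (by have := hs j; positivity))
  have heq : (fun n ω => Real.exp (t * ∑ j ∈ Finset.range (n + 1), X j ω)) =
      fun n ω => ∏ j ∈ Finset.range (n + 1), Real.exp (t * X j ω) := by
    ext n ω
    rw [Finset.mul_sum, Real.exp_sum]
  exact ⟨_, heq ▸ h⟩

omit [IsProbabilityMeasure P] in
theorem integral_exp_sum_le (hX : ∀ j, Measurable (X j)) (hind : iIndepFun X P)
    (hmgf : ∀ j t, mgf (X j) P t = Real.exp (t ^ 2 * s j / 2))
    (hV : ∀ J, ∑ j ∈ Finset.range J, s j ≤ V) (J : ℕ) (t : ℝ) :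
    Integrable (fun ω => Real.exp (t * ∑ j ∈ Finset.range J, X j ω)) P ∧
    ∫ ω, Real.exp (t * ∑ j ∈ Finset.range J, X j ω) ∂P ≤ Real.exp (t ^ 2 * V / 2) := by
  have h := hind.mgf_sum hX (Finset.range J) (t := t)
  simp only [hmgf, ← Real.exp_sum] at h
  refine ⟨by simpa using integrable_exp_of_mgf_eq_exp h, ?_⟩
  have h' : ∫ ω, Real.exp (t * ∑ j ∈ Finset.range J, X j ω) ∂P =
    Real.exp (∑ i ∈ Finset.range J, t ^ 2 * s i / 2) := by rw [← h]; simp [mgf]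
  rw [h', ← Finset.sum_div, ← Finset.mul_sum]
  gcongr
  exact hV J

/-- Doob's maximal inequality at each finite horizon, with a bound independent of the horizon,
followed by continuity from below along the increasing events. -/
theorem measure_exists_le_sum_le (hX : ∀ j, Measurable (X j)) (hind : iIndepFun X P)
    (hmgf : ∀ j t, mgf (X j) P t = Real.exp (t ^ 2 * s j / 2)) (hs : ∀ j, 0 ≤ s j)
    (hV : ∀ J, ∑ j ∈ Finset.range J, s j ≤ V) (a : ℝ) (ha : 0 < a) (t : ℝ) :
    P {ω | ∃ J, a ≤ t * ∑ j ∈ Finset.range J, X j ω} ≤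
      ENNReal.ofReal (Real.exp (t ^ 2 * V / 2 - a)) := by
  obtain ⟨ℱ, hsub⟩ := submartingale_exp_sum hX hind hmgf hs t
  let A : ℕ → Set Ω := fun n => {ω | ∃ J ≤ n, a ≤ t * ∑ j ∈ Finset.range (J + 1), X j ω}
  have hA : {ω | ∃ J, a ≤ t * ∑ j ∈ Finset.range J, X j ω} ⊆ ⋃ n, A n := by
    rintro ω ⟨J, hJ⟩
    rcases J with _ | J
    -- The empty sum never reaches `a > 0`, so the submartingale may start at one summand.
    · simp at hJ; linarith
    · exact Set.mem_iUnion.2 ⟨J, J, le_rfl, hJ⟩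
  have hmono : Monotone A := fun m n hmn ω ⟨J, hJ, h⟩ => ⟨J, hJ.trans hmn, h⟩
  refine (measure_mono hA).trans ?_
  rw [hmono.measure_iUnion]
  refine iSup_le fun n => ?_
  let e : NNReal := ⟨Real.exp a, (Real.exp_pos a).le⟩
  have hm := maximal_ineq hsub (fun n ω => (Real.exp_pos _).le) (ε := e) n
  have hint := integral_exp_sum_le hX hind hmgf hV (n + 1) t
  have h1 : ENNReal.ofReal (∫ ω in {ω | (e : ℝ) ≤ (Finset.range (n + 1)).sup'
      Finset.nonempty_range_add_one fun k => Real.exp (t * ∑ j ∈ Finset.range (k + 1), X j ω)},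
      Real.exp (t * ∑ j ∈ Finset.range (n + 1), X j ω) ∂P) ≤
      ENNReal.ofReal (Real.exp (t ^ 2 * V / 2)) := by
    apply ENNReal.ofReal_le_ofReal
    refine (setIntegral_le_integral hint.1 (ae_of_all _ fun _ => (Real.exp_pos _).le)).trans hint.2
  have h2 : A n ⊆ {ω | (e : ℝ) ≤ (Finset.range (n + 1)).sup'
      Finset.nonempty_range_add_one fun k => Real.exp (t * ∑ j ∈ Finset.range (k + 1), X j ω)} := by
    rintro ω ⟨J, hJ, h⟩
    refine (Real.exp_le_exp.2 h).trans ?_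
    exact Finset.le_sup' (fun k => Real.exp (t * ∑ j ∈ Finset.range (k + 1), X j ω))
      (by simpa [Nat.lt_succ_iff] using hJ)
  have h3 := (mul_le_mul_right (measure_mono (μ := P) h2) (e : ℝ≥0∞)).trans (hm.trans h1)
  have he : (e : ℝ≥0∞) = ENNReal.ofReal (Real.exp a) := (ENNReal.ofReal_eq_coe_nnreal _).symm
  rw [he] at h3
  rw [Real.exp_sub, ENNReal.ofReal_div_of_pos (Real.exp_pos a), ENNReal.le_div_iff_mul_le, mul_comm]
  · exact h3
  · left; simp [Real.exp_pos]
  · left; simp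

/-- Maximal inequality: the partial sums exceed `r` with Gaussian probability. -/
theorem measure_exists_le_abs_sum_le (hX : ∀ j, Measurable (X j)) (hind : iIndepFun X P)
    (hmgf : ∀ j t, mgf (X j) P t = Real.exp (t ^ 2 * s j / 2)) (hs : ∀ j, 0 ≤ s j)
    (hV : ∀ J, ∑ j ∈ Finset.range J, s j ≤ V) (hV0 : 0 < V) (r : ℝ) (hr : 0 < r) :
    P {ω | ∃ J, r ≤ |∑ j ∈ Finset.range J, X j ω|} ≤
      ENNReal.ofReal (2 * Real.exp (-(r ^ 2 / (2 * V)))) := by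
  -- `t = ± r / V` minimizes the exponent `t ^ 2 * V / 2 - |t| * r`.
  have h1 := measure_exists_le_sum_le hX hind hmgf hs hV (r / V * r) (by positivity) (r / V)
  have h2 := measure_exists_le_sum_le hX hind hmgf hs hV (r / V * r) (by positivity) (-(r / V))
  have e1 : (r / V) ^ 2 * V / 2 - r / V * r = -(r ^ 2 / (2 * V)) := by field_simp; ring
  rw [neg_sq] at h2
  rw [e1] at h1 h2
  have hsub : {ω | ∃ J, r ≤ |∑ j ∈ Finset.range J, X j ω|} ⊆
      {ω | ∃ J, r / V * r ≤ r / V * ∑ j ∈ Finset.range J, X j ω} ∪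
      {ω | ∃ J, r / V * r ≤ -(r / V) * ∑ j ∈ Finset.range J, X j ω} := by
    rintro ω ⟨J, hJ⟩
    have : 0 ≤ r / V := by positivity
    rcases le_abs.1 hJ with h | h
    · exact Or.inl ⟨J, by gcongr⟩
    · exact Or.inr ⟨J, by rw [neg_mul, ← mul_neg]; gcongr⟩
  refine (measure_mono hsub).trans ((measure_union_le _ _).trans ((add_le_add h1 h2).trans ?_))
  rw [← ENNReal.ofReal_add (by positivity) (by positivity), ← two_mul]

/-- The `L¹`-bounded submartingales `exp (± S)` converge almost surely. Their limits multiply to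
one, so neither vanishes and the logarithm gives the limit of `S`. -/
theorem ae_exists_tendsto_sum (hX : ∀ j, Measurable (X j)) (hind : iIndepFun X P)
    (hmgf : ∀ j t, mgf (X j) P t = Real.exp (t ^ 2 * s j / 2)) (hs : ∀ j, 0 ≤ s j)
    (hV : ∀ J, ∑ j ∈ Finset.range J, s j ≤ V) :
    ∀ᵐ ω ∂P, ∃ l : ℝ, Tendsto (fun J => ∑ j ∈ Finset.range J, X j ω) atTop (𝓝 l) := by
  have key : ∀ t : ℝ, ∀ᵐ ω ∂P, ∃ l : ℝ, Tendsto (fun J =>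
      Real.exp (t * ∑ j ∈ Finset.range (J + 1), X j ω)) atTop (𝓝 l) := by
    intro t
    obtain ⟨ℱ, hsub⟩ := submartingale_exp_sum hX hind hmgf hs t
    have := hsub.ae_tendsto_limitProcess (R := (Real.exp (t ^ 2 * V / 2)).toNNReal) (fun n => by
      have hint := integral_exp_sum_le hX hind hmgf hV (n + 1) t
      rw [eLpNorm_one_eq_lintegral_enorm]
      have : ∀ ω, ‖Real.exp (t * ∑ j ∈ Finset.range (n + 1), X j ω)‖ₑ =
        ENNReal.ofReal (Real.exp (t * ∑ j ∈ Finset.range (n + 1), X j ω)) := fun ω =>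
          Real.enorm_of_nonneg (Real.exp_pos _).le
      simp only [this]
      rw [← ofReal_integral_eq_lintegral_ofReal hint.1 (ae_of_all _ fun _ => (Real.exp_pos _).le)]
      exact ENNReal.ofReal_le_ofReal hint.2)
    filter_upwards [this] with ω h using ⟨_, h⟩
  filter_upwards [key 1, key (-1)] with ω ⟨l, hl⟩ ⟨m, hm⟩
  have hlm : l * m = 1 := by
    refine tendsto_nhds_unique (hl.mul hm) ?_
    simp [← Real.exp_add]
  have hl0 : l ≠ 0 := left_ne_zero_of_mul_eq_one hlm
  refine ⟨Real.log l, (tendsto_add_atTop_iff_nat 1).1 ?_⟩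
  simpa using hl.log hl0

end Series

/-! ### Gaussian white noise -/

section WhiteNoise

variable {Ω Y : Type*} [MeasurableSpace Ω] {P : Measure Ω} [NormedAddCommGroup Y]
  [InnerProductSpace ℝ Y]

theorem IsOrthonormalSequenceBasis.inner_eq_zero {ψ : ℕ → Y} (hψ : IsOrthonormalSequenceBasis ψ)
    {i j : ℕ} (hij : i ≠ j) : inner ℝ (ψ i) (ψ j) = 0 := by
  by_cases hi : ψ i = 0
  · simp [hi]
  by_cases hj : ψ j = 0
  · simp [hj]
  exact hψ.orthonormal.2 (i := ⟨i, hi⟩) (j := ⟨j, hj⟩) (by simpa using hij)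

theorem IsOrthonormalSequenceBasis.sum_inner_sq_le {ψ : ℕ → Y}
    (hψ : IsOrthonormalSequenceBasis ψ) (v : Y) (J : ℕ) :
    ∑ j ∈ Finset.range J, inner ℝ (ψ j) v ^ 2 ≤ ‖v‖ ^ 2 := by
  classical
  have h := hψ.orthonormal.sum_inner_products_le v
    (s := (Finset.range J).subtype fun j => ψ j ≠ 0)
  have e : ∑ j ∈ Finset.range J, inner ℝ (ψ j) v ^ 2 =
      ∑ j ∈ Finset.range J with ψ j ≠ 0, inner ℝ (ψ j) v ^ 2 := by
    rw [Finset.sum_filter]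
    refine Finset.sum_congr rfl fun j _ => ?_
    split_ifs with h0
    · rfl
    · push Not at h0; simp [h0]
  rw [e, ← Finset.sum_subtype_eq_sum_filter]
  simpa using h

/-- The summands of the canonical version of white noise at a fixed vector are independent centred
Gaussian variables with summable variances. -/
theorem IsGaussianWhiteNoise.series {W : Y → Ω → ℝ} [IsProbabilityMeasure P]
    (hW : IsGaussianWhiteNoise P W) {ψ : ℕ → Y} (hψ : IsOrthonormalSequenceBasis ψ) (v : Y) :
    (∀ j, Measurable fun ω => inner ℝ (ψ j) v * W (ψ j) ω) ∧
    iIndepFun (fun j ω => inner ℝ (ψ j) v * W (ψ j) ω) P ∧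
    ∀ j t, mgf (fun ω => inner ℝ (ψ j) v * W (ψ j) ω) P t =
      Real.exp (t ^ 2 * inner ℝ (ψ j) v ^ 2 / 2) := by
  refine ⟨fun j => (hW.measurable _).const_mul _, ?_, fun j t => ?_⟩
  -- Each coordinate is regarded as a process over `Unit`, so that jointly Gaussian families with
  -- zero cross-covariance are independent.
  · have h1 : IsGaussianProcess (fun (p : (_ : ℕ) × Unit) ω => W (ψ p.1) ω) P :=
      hW.gaussian.comp_right (fun p : (_ : ℕ) × Unit => ψ p.1)
    have h2 := IsGaussianProcess.iIndepFun_of_covariance_eq_zero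
      (X := fun (j : ℕ) (_ : Unit) => W (ψ j)) h1 (fun j _ => (hW.measurable _).aemeasurable)
      (fun i j hij _ _ => by rw [hW.covariance, hψ.inner_eq_zero hij])
    exact h2.comp (fun j w => inner ℝ (ψ j) v * w ()) (fun j => by fun_prop)
  · have h3 := (hW.gaussian.hasGaussianLaw_eval (ψ j)).map_eq_gaussianReal
    have h4 := mgf_gaussianReal h3 (inner ℝ (ψ j) v * t)
    rw [hW.mean_zero, ← covariance_self (hW.measurable _).aemeasurable, hW.covariance] at h4
    have h5 : mgf (fun ω => inner ℝ (ψ j) v * W (ψ j) ω) P t =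
        mgf (W (ψ j)) P (inner ℝ (ψ j) v * t) := by
      simp only [mgf]
      congr 1; ext ω; congr 1; ring
    rw [h5, h4]
    congr 1
    by_cases hj : ψ j = 0
    · simp [hj]
    · have : ‖ψ j‖ = 1 := hψ.orthonormal.1 ⟨j, hj⟩
      rw [real_inner_self_eq_norm_sq, this]
      simp
      ring

variable {W : Y → Ω → ℝ} [IsProbabilityMeasure P] {ψ : ℕ → Y}

theorem IsGaussianWhiteNoise.lintegral_exp_le (hW : IsGaussianWhiteNoise P W)
    (hψ : IsOrthonormalSequenceBasis ψ) (v : Y) (J : ℕ) (t : ℝ) :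
    ∫⁻ ω, ENNReal.ofReal (Real.exp (t * ∑ j ∈ Finset.range J, inner ℝ (ψ j) v * W (ψ j) ω
      - t ^ 2 * ‖v‖ ^ 2)) ∂P ≤ 1 := by
  obtain ⟨h1, h2, h3⟩ := hW.series hψ v
  obtain ⟨h4, h5⟩ := integral_exp_sum_le h1 h2 h3 (hψ.sum_inner_sq_le v) J t
  simp only [Real.exp_sub]
  rw [← ofReal_integral_eq_lintegral_ofReal (h4.div_const _) (ae_of_all _ fun _ => by positivity),
    integral_div]
  rw [ENNReal.ofReal_le_one]
  refine (div_le_one (Real.exp_pos _)).2 (h5.trans (Real.exp_le_exp.2 ?_))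
  nlinarith [mul_nonneg (sq_nonneg t) (sq_nonneg ‖v‖)]

theorem IsGaussianWhiteNoise.measure_exists_le (hW : IsGaussianWhiteNoise P W)
    (hψ : IsOrthonormalSequenceBasis ψ) (v : Y) {d : ℝ} (hd : 0 < d) (hv : ‖v‖ ≤ d)
    {r : ℝ} (hr : 0 < r) :
    P {ω | ∃ J, r ≤ |∑ j ∈ Finset.range J, inner ℝ (ψ j) v * W (ψ j) ω|} ≤
      ENNReal.ofReal (2 * Real.exp (-(r ^ 2 / (2 * d ^ 2)))) := by
  obtain ⟨h1, h2, h3⟩ := hW.series hψ v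
  exact measure_exists_le_abs_sum_le h1 h2 h3 (fun _ => sq_nonneg _)
    (fun J => (hψ.sum_inner_sq_le v J).trans (by gcongr)) (by positivity) r hr

theorem IsGaussianWhiteNoise.ae_exists_tendsto (hW : IsGaussianWhiteNoise P W)
    (hψ : IsOrthonormalSequenceBasis ψ) (v : Y) :
    ∀ᵐ ω ∂P, ∃ l : ℝ, Tendsto (fun J => ∑ j ∈ Finset.range J, inner ℝ (ψ j) v * W (ψ j) ω)
      atTop (𝓝 l) := by
  obtain ⟨h1, h2, h3⟩ := hW.series hψ v
  exact ae_exists_tendsto_sum h1 h2 h3 (fun _ => sq_nonneg _) (hψ.sum_inner_sq_le v)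

end WhiteNoise

/-! ### Sub-Gaussian vectors -/

section SubGaussian

/-- The linear term disappears in expectation for centred variables, leaving only an exponential
moment of the square. -/
theorem Real.exp_le_add_exp_sq (x : ℝ) : Real.exp x ≤ x + Real.exp (x ^ 2) := by
  have h1 := Real.add_one_le_exp (x ^ 2)
  rcases le_or_gt |x| 1 with h | h
  · have := (abs_le.1 (Real.abs_exp_sub_one_sub_id_le h)).2
    linarith
  · rcases lt_abs.1 h with h | h
    · have : Real.exp x ≤ Real.exp (x ^ 2) := Real.exp_le_exp.2 (by nlinarith)
      linarith
    · have : Real.exp x ≤ 1 := Real.exp_le_one_iff.2 (by linarith)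
      nlinarith

variable {Ω Y : Type*} [MeasurableSpace Ω] {P : Measure Ω} [IsProbabilityMeasure P]
  [NormedAddCommGroup Y] [InnerProductSpace ℝ Y] [MeasurableSpace Y] [BorelSpace Y]
  [CompleteSpace Y] [SecondCountableTopology Y]

/-- A bound for the exponential square moment of a sub-Gaussian vector with parameter one. -/
noncomputable def expSqMomentBound : ℝ := 2 * Real.exp (1 / 4) * (1 - Real.exp (-(1 / 4)))⁻¹

theorem one_le_expSqMomentBound : 1 ≤ expSqMomentBound := by
  have h1 : 1 ≤ Real.exp (1 / 4) := Real.one_le_exp (by norm_num)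
  have h2 : Real.exp (-(1 / 4)) < 1 := (Real.exp_lt_exp.2 (by norm_num : -(1 / 4 : ℝ) < 0)).trans_eq Real.exp_zero
  have h3 : 1 ≤ (1 - Real.exp (-(1 / 4)))⁻¹ :=
    (one_le_inv₀ (by linarith)).2 (by linarith [Real.exp_pos (-(1 / 4 : ℝ))])
  unfold expSqMomentBound
  nlinarith

-- Slicing by the integer part k of `‖ε‖ ^ 2`, the tail exp(-k/2) beats exp((k + 1)/4), and the
-- geometric series sums to the constant.
omit [CompleteSpace Y] [SecondCountableTopology Y] in
theorem IsSubGaussianVector.lintegral_exp_sq_le {ε : Ω → Y} (h : IsSubGaussianVector P ε 1) :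
    ∫⁻ ω, ENNReal.ofReal (Real.exp (‖ε ω‖ ^ 2 / 4)) ∂P ≤ ENNReal.ofReal expSqMomentBound := by
  have hm : ∀ k : ℕ, MeasurableSet {ω | √k ≤ ‖ε ω‖} := fun k =>
    measurableSet_le measurable_const h.measurable.norm
  have hpt : ∀ ω, ENNReal.ofReal (Real.exp (‖ε ω‖ ^ 2 / 4)) ≤
      ∑' k : ℕ, {ω | √k ≤ ‖ε ω‖}.indicator
        (fun _ => ENNReal.ofReal (Real.exp ((k + 1 : ℝ) / 4))) ω := by
    intro ω
    refine le_trans ?_ (ENNReal.le_tsum ⌊‖ε ω‖ ^ 2⌋₊)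
    rw [Set.indicator_of_mem]
    · gcongr
      exact (Nat.lt_floor_add_one _).le
    · exact Real.sqrt_le_iff.2 ⟨norm_nonneg _, Nat.floor_le (by positivity)⟩
  refine (lintegral_mono hpt).trans ?_
  rw [lintegral_tsum fun k => (measurable_const.indicator (hm k)).aemeasurable]
  have hk : ∀ k : ℕ, ∫⁻ ω, {ω | √k ≤ ‖ε ω‖}.indicator
        (fun _ => ENNReal.ofReal (Real.exp ((k + 1 : ℝ) / 4))) ω ∂P ≤
      ENNReal.ofReal (2 * Real.exp (1 / 4) * Real.exp (-(1 / 4)) ^ k) := by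
    intro k
    rw [lintegral_indicator (hm k), setLIntegral_const]
    have ht := h.tail (√k) (Real.sqrt_nonneg _)
    rw [Real.sq_sqrt (Nat.cast_nonneg k)] at ht
    rw [← ofReal_measureReal, ← ENNReal.ofReal_mul (Real.exp_pos _).le]
    refine ENNReal.ofReal_le_ofReal ((mul_le_mul_of_nonneg_left ht (Real.exp_pos _).le).trans_eq ?_)
    rw [← Real.exp_nat_mul, mul_left_comm, mul_assoc, ← Real.exp_add, ← Real.exp_add]
    congr 2
    ring
  refine (ENNReal.tsum_le_tsum hk).trans ?_
  have h2 : Real.exp (-(1 / 4)) < 1 := (Real.exp_lt_exp.2 (by norm_num : -(1 / 4 : ℝ) < 0)).trans_eq Real.exp_zero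
  have hs := (hasSum_geometric_of_lt_one (Real.exp_pos (-(1 / 4))).le h2).mul_left
    (2 * Real.exp (1 / 4))
  rw [← ENNReal.ofReal_tsum_of_nonneg (fun k => by positivity) hs.summable, hs.tsum_eq]
  rfl

/-- The variance proxy used for both noise models. -/
noncomputable def noiseProxy : ℝ := 4 * expSqMomentBound

theorem one_le_noiseProxy : 1 ≤ noiseProxy := by
  have := one_le_expSqMomentBound
  unfold noiseProxy; linarith

/-- With `s = t ^ 2 * ‖v‖ ^ 2`, centring matters only for small `s`, where the bound must be 1 +
O(s). For large `s`, Young's inequality and the exponential square moment suffice. -/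
theorem IsSubGaussianVector.lintegral_exp_le {ε : Ω → Y} (h : IsSubGaussianVector P ε 1)
    (v : Y) (t : ℝ) :
    ∫⁻ ω, ENNReal.ofReal (Real.exp (t * inner ℝ (ε ω) v - noiseProxy * (t ^ 2 * ‖v‖ ^ 2))) ∂P
      ≤ 1 := by
  set K := expSqMomentBound with hK
  have hK1 : 1 ≤ K := one_le_expSqMomentBound
  have hmeas : Measurable fun ω => Real.exp (‖ε ω‖ ^ 2 / 4) :=
    ((h.measurable.norm.pow_const 2).div_const 4).exp
  have hint : Integrable (fun ω => Real.exp (‖ε ω‖ ^ 2 / 4)) P := by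
    refine ⟨hmeas.aestronglyMeasurable, ?_⟩
    rw [hasFiniteIntegral_iff_ofReal (ae_of_all _ fun _ => (Real.exp_pos _).le)]
    exact h.lintegral_exp_sq_le.trans_lt ENNReal.ofReal_lt_top
  have hE : ∫ ω, Real.exp (‖ε ω‖ ^ 2 / 4) ∂P ≤ K := by
    have := h.lintegral_exp_sq_le
    rw [← ofReal_integral_eq_lintegral_ofReal hint (ae_of_all _ fun _ => (Real.exp_pos _).le)]
      at this
    exact (ENNReal.ofReal_le_ofReal_iff (by linarith)).1 this
  have hεint : Integrable ε P := by
    refine (hint.const_mul 4).mono' h.measurable.aestronglyMeasurable (ae_of_all _ fun ω => ?_)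
    have := Real.add_one_le_exp (‖ε ω‖ ^ 2 / 4)
    nlinarith [sq_nonneg (‖ε ω‖ - 1)]
  have hZint : Integrable (fun ω => inner ℝ (ε ω) v) P := hεint.inner_const (𝕜 := ℝ) v
  have hZ0 : ∫ ω, inner ℝ (ε ω) v ∂P = 0 := by
    have := integral_inner (𝕜 := ℝ) hεint v
    rw [h.mean_zero, inner_zero_right] at this
    rw [← this]
    exact integral_congr_ae (ae_of_all _ fun ω => real_inner_comm _ _)
  set s : ℝ := t ^ 2 * ‖v‖ ^ 2 with hs
  have hs0 : 0 ≤ s := by positivity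
  have hcs : ∀ ω, (t * inner ℝ (ε ω) v) ^ 2 ≤ s * ‖ε ω‖ ^ 2 := by
    intro ω
    have := abs_real_inner_le_norm (ε ω) v
    have h2 : inner ℝ (ε ω) v ^ 2 ≤ (‖ε ω‖ * ‖v‖) ^ 2 := sq_le_sq.2 (by
      rwa [abs_of_nonneg (by positivity : 0 ≤ ‖ε ω‖ * ‖v‖)])
    nlinarith [mul_le_mul_of_nonneg_left h2 (sq_nonneg t)]
  -- an integrable pointwise bound whose mean is at most `exp (4 K s)`
  obtain ⟨B, hBint, hB, hBE⟩ : ∃ B : Ω → ℝ, Integrable B P ∧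
      (∀ ω, Real.exp (t * inner ℝ (ε ω) v) ≤ B ω) ∧ ∫ ω, B ω ∂P ≤ Real.exp (4 * K * s) := by
    rcases le_or_gt s (1 / 4) with hle | hgt
    · refine ⟨fun ω => t * inner ℝ (ε ω) v + ((1 - 4 * s) + 4 * s * Real.exp (‖ε ω‖ ^ 2 / 4)),
        (hZint.const_mul t).add ((integrable_const _).add (hint.const_mul _)), fun ω => ?_, ?_⟩
      · refine (Real.exp_le_add_exp_sq _).trans (add_le_add_right ?_ _)
        -- Convexity between 0 and `‖ε‖ ^ 2 / 4` with weight `4 * s ≤ 1` makes the excess over 1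
        -- linear in `s`.
        have hc := convexOn_exp.2 (Set.mem_univ 0) (Set.mem_univ (‖ε ω‖ ^ 2 / 4))
          (by linarith : 0 ≤ 1 - 4 * s) (by linarith : 0 ≤ 4 * s) (by ring)
        simp only [smul_eq_mul, mul_zero, zero_add, Real.exp_zero, mul_one] at hc
        refine le_trans (Real.exp_le_exp.2 ?_) hc
        linarith [hcs ω]
      · show ∫ ω, (t * inner ℝ (ε ω) v + ((1 - 4 * s) + 4 * s * Real.exp (‖ε ω‖ ^ 2 / 4))) ∂P ≤ _
        rw [integral_add (f := fun ω => t * inner ℝ (ε ω) v)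
          (g := fun ω => (1 - 4 * s) + 4 * s * Real.exp (‖ε ω‖ ^ 2 / 4)) (hZint.const_mul t) ((integrable_const _).add (hint.const_mul _)),
          integral_const_mul, hZ0, integral_add (integrable_const _) (hint.const_mul _),
          integral_const_mul]
        simp only [mul_zero, zero_add, integral_const, probReal_univ, one_smul]
        have := Real.add_one_le_exp (4 * K * s)
        nlinarith [mul_le_mul_of_nonneg_left hE hs0]
    · refine ⟨fun ω => Real.exp s * Real.exp (‖ε ω‖ ^ 2 / 4), hint.const_mul _, fun ω => ?_, ?_⟩
      · refine le_of_le_of_eq ?_ (Real.exp_add _ _)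
        refine Real.exp_le_exp.2 ?_
        have h1 : t * inner ℝ (ε ω) v ≤ |t| * (‖ε ω‖ * ‖v‖) := by
          refine (le_abs_self _).trans ?_
          rw [abs_mul]
          gcongr
          exact abs_real_inner_le_norm _ _
        have h2 : s = (|t| * ‖v‖) ^ 2 := by rw [hs, mul_pow, sq_abs]
        nlinarith [sq_nonneg (|t| * ‖v‖ - ‖ε ω‖ / 2)]
      · rw [integral_const_mul]
        have h1 : K ≤ Real.exp (K - 1) := by linarith [Real.add_one_le_exp (K - 1)]
        calc Real.exp s * ∫ ω, Real.exp (‖ε ω‖ ^ 2 / 4) ∂P ≤ Real.exp s * Real.exp (K - 1) := by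
              gcongr; exact hE.trans h1
          _ = Real.exp (s + (K - 1)) := (Real.exp_add _ _).symm
          -- Here `4 * s > 1` lets `4 * K * s` absorb the additive `K - 1`.
          _ ≤ _ := Real.exp_le_exp.2 (by nlinarith)
  simp only [Real.exp_sub]
  have hle : ∀ ω, ENNReal.ofReal (Real.exp (t * inner ℝ (ε ω) v) / Real.exp (noiseProxy * s)) ≤
      ENNReal.ofReal (B ω / Real.exp (noiseProxy * s)) := fun ω =>
    ENNReal.ofReal_le_ofReal (by gcongr; exact hB ω)
  refine (lintegral_mono hle).trans ?_
  rw [← ofReal_integral_eq_lintegral_ofReal (hBint.div_const _)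
    (ae_of_all _ fun ω => div_nonneg ((Real.exp_pos _).le.trans (hB ω)) (Real.exp_pos _).le),
    integral_div, ENNReal.ofReal_le_one]
  exact (div_le_one (Real.exp_pos _)).2 hBE

end SubGaussian
/-! ### Noise models and independent designs -/

section Independence

variable {Ω : Type*} [MeasurableSpace Ω] {P : Measure Ω} [IsProbabilityMeasure P]

/-- Fubini for independent random elements, as a bound on probabilities. -/
theorem ProbabilityTheory.IndepFun.measure_le_of_forall_measure_le {A B : Type*} [MeasurableSpace A]
    [MeasurableSpace B] {U : Ω → A} {V : Ω → B} (hU : Measurable U) (hV : Measurable V)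
    (hUV : IndepFun U V P) {S : Set (A × B)} (hS : MeasurableSet S) {c : ℝ≥0∞}
    (h : ∀ᵐ ω ∂P, P {ω' | (U ω, V ω') ∈ S} ≤ c) :
    P {ω | (U ω, V ω) ∈ S} ≤ c := by
  have h1 := (indepFun_iff_map_prod_eq_prod_map_map hU.aemeasurable hV.aemeasurable).1 hUV
  have : IsProbabilityMeasure (P.map U) := Measure.isProbabilityMeasure_map hU.aemeasurable
  have : IsProbabilityMeasure (P.map V) := Measure.isProbabilityMeasure_map hV.aemeasurable
  have h2 : P {ω | (U ω, V ω) ∈ S} = (P.map fun ω => (U ω, V ω)) S :=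
    (Measure.map_apply (hU.prodMk hV) hS).symm
  rw [h2, h1, Measure.prod_apply hS,
    lintegral_map (measurable_measure_prodMk_left hS) hU]
  calc _ ≤ ∫⁻ _, c ∂P := by
        refine lintegral_mono_ae ?_
        filter_upwards [h] with ω h
        rw [Measure.map_apply hV (measurable_prodMk_left hS)]
        exact h
    _ = c := by simp

/-- Conditionally on a design that is independent of independent noise variables, expectations
of products factorize. -/
theorem lintegral_prod_le_one {A E : Type*} [MeasurableSpace A] [MeasurableSpace E] {n : ℕ}
    {x : Fin n → Ω → A} {η : Fin n → Ω → E} (hx : ∀ i, Measurable (x i))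
    (hη : ∀ i, Measurable (η i)) (hind : iIndepFun η P)
    (hxη : IndepFun (fun ω i => x i ω) (fun ω i => η i ω) P) {φ : A → E → ℝ≥0∞}
    (hφ : Measurable (Function.uncurry φ)) (h : ∀ a i, ∫⁻ ω, φ a (η i ω) ∂P ≤ 1) :
    ∫⁻ ω, ∏ i, φ (x i ω) (η i ω) ∂P ≤ 1 := by
  have hX : Measurable fun ω i => x i ω := measurable_pi_lambda _ hx
  have hE : Measurable fun ω i => η i ω := measurable_pi_lambda _ hη
  have : IsProbabilityMeasure (P.map fun ω i => x i ω) :=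
    Measure.isProbabilityMeasure_map hX.aemeasurable
  have : IsProbabilityMeasure (P.map fun ω i => η i ω) :=
    Measure.isProbabilityMeasure_map hE.aemeasurable
  have h1 := (indepFun_iff_map_prod_eq_prod_map_map hX.aemeasurable hE.aemeasurable).1 hxη
  have hF : Measurable fun p : (Fin n → A) × (Fin n → E) => ∏ i, φ (p.1 i) (p.2 i) :=
    Finset.measurable_prod _ fun i _ => hφ.comp (f := fun p : (Fin n → A) × (Fin n → E) =>
      (p.1 i, p.2 i)) (((measurable_pi_apply i).comp measurable_fst).prodMk
        ((measurable_pi_apply i).comp measurable_snd))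
  have h2 := lintegral_map (μ := P) hF (hX.prodMk hE)
  refine h2.symm.trans_le ?_
  rw [h1, lintegral_prod _ hF.aemeasurable]
  calc _ ≤ ∫⁻ _, 1 ∂(P.map fun ω i => x i ω) := by
        refine lintegral_mono fun a => ?_
        have hφa : ∀ i, Measurable (φ (a i)) := fun i => hφ.of_uncurry_left
        rw [lintegral_map (f := fun y : Fin n → E => ∏ i, φ (a i) (y i))
          (hF.comp measurable_prodMk_left) hE]
        have hI : iIndepFun (fun i ω => φ (a i) (η i ω)) P := hind.comp (fun i => φ (a i)) hφa
        rw [lintegral_prod_eq_prod_lintegral_of_indepFun Finset.univ _ hI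
          fun i => (hφa i).comp (hη i)]
        exact Finset.prod_le_one' fun i _ => h _ i
    _ = 1 := by simp

end Independence

/-! ### Common properties of the two noise models -/

section Noise

variable {Ω X Y : Type*} [MeasurableSpace Ω] {P : Measure Ω} [IsProbabilityMeasure P]
  [TopologicalSpace X] [MeasurableSpace X]
  [NormedAddCommGroup Y] [InnerProductSpace ℝ Y]

/-- The noise functionals `ξ i`, evaluated along differences of regression functions, have
conditionally sub-Gaussian sums. -/
structure IsSubGaussianNoise (P : Measure Ω) {n : ℕ} (x : Fin n → Ω → X)
    (ξ : Fin n → Ω → Y → ℝ) [MeasurableSpace Y] : Prop where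
  aemeasurable : ∀ G : X → Y, Measurable G → ∀ i, AEMeasurable (fun ω => ξ i ω (G (x i ω))) P
  lintegral_exp_le : ∀ G G' : X → Y, Measurable G → Measurable G' → ∀ t : ℝ,
    ∫⁻ ω, ENNReal.ofReal (Real.exp (t * ∑ i, (ξ i ω (G (x i ω)) - ξ i ω (G' (x i ω)))
      - noiseProxy * (t ^ 2 * ∑ i, ‖G (x i ω) - G' (x i ω)‖ ^ 2))) ∂P ≤ 1

/-- Almost surely, the noise functionals are continuous along all approximating sequences chosen
from the sets `T k`. -/
def IsChainContinuousNoise (γ : Measure X) (P : Measure Ω) {n : ℕ} (x : Fin n → Ω → X)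
    (ξ : Fin n → Ω → Y → ℝ) (T : ℕ → Finset (X → Y)) (d : ℕ → ℝ) : Prop :=
  ∀ᵐ ω ∂P, ∀ (G : X → Y) (g : ℕ → X → Y), (∀ k, g k ∈ T k) →
    (∀ k, ∀ a ∈ γ.support, ‖G a - g k a‖ ≤ d k) →
    ∀ i, Tendsto (fun k => ξ i ω (g k (x i ω))) atTop (𝓝 (ξ i ω (G (x i ω))))

theorem prod_ofReal_exp_sum {n : ℕ} (t K : ℝ) (a b : Fin n → ℝ) :
    ENNReal.ofReal (Real.exp (t * ∑ i, a i - K * (t ^ 2 * ∑ i, b i))) =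
      ∏ i, ENNReal.ofReal (Real.exp (t * a i - K * (t ^ 2 * b i))) := by
  rw [← ENNReal.ofReal_prod_of_nonneg fun _ _ => (Real.exp_pos _).le, ← Real.exp_sum,
    Finset.sum_sub_distrib, Finset.mul_sum, Finset.mul_sum, Finset.mul_sum]

omit [TopologicalSpace X] in
theorem IsSubGaussianNoiseModel.isSubGaussianNoise [MeasurableSpace Y] [BorelSpace Y]
    [CompleteSpace Y] [SecondCountableTopology Y] {n : ℕ} {x : Fin n → Ω → X}
    {ξ : Fin n → Ω → Y → ℝ} (hx : ∀ i, Measurable (x i)) (h : IsSubGaussianNoiseModel P x ξ) :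
    IsSubGaussianNoise P x ξ := by
  obtain ⟨ε, hε, hind, hxε, hξ⟩ := h
  refine ⟨fun G hG i => ?_, fun G G' hG hG' t => ?_⟩
  · simp only [hξ]
    exact ((hε i).measurable.inner (hG.comp (hx i))).aemeasurable
  · have hφ : Measurable (Function.uncurry fun (a : X) (e : Y) => ENNReal.ofReal (Real.exp
        (t * inner ℝ e (G a - G' a) - noiseProxy * (t ^ 2 * ‖G a - G' a‖ ^ 2)))) := by
      have h1 : Measurable fun p : X × Y => G p.1 - G' p.1 :=
        (hG.comp measurable_fst).sub (hG'.comp measurable_fst)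
      exact (((measurable_snd.inner h1).const_mul t).sub
        (((h1.norm.pow_const 2).const_mul _).const_mul _)).exp.ennreal_ofReal
    refine le_of_eq_of_le ?_ (lintegral_prod_le_one hx (fun i => (hε i).measurable) hind hxε hφ
      fun a i => (hε i).lintegral_exp_le (G a - G' a) t)
    refine lintegral_congr fun ω => ?_
    rw [prod_ofReal_exp_sum]
    simp only [hξ, inner_sub_right]

omit [MeasurableSpace X] [IsProbabilityMeasure P] in
theorem tendsto_of_forall_norm_sub_le {F : Type*} [NormedAddCommGroup F] {u : ℕ → F} {v : F}
    {d : ℕ → ℝ} (hd : Tendsto d atTop (𝓝 0)) (h : ∀ k, ‖v - u k‖ ≤ d k) :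
    Tendsto u atTop (𝓝 v) := by
  rw [tendsto_iff_norm_sub_tendsto_zero]
  exact squeeze_zero (fun _ => norm_nonneg _) (fun k => norm_sub_rev (u k) v ▸ h k) hd

omit [IsProbabilityMeasure P] in
theorem IsSubGaussianNoiseModel.isChainContinuousNoise [MeasurableSpace Y] {n : ℕ}
    {γ : Measure X} {x : Fin n → Ω → X} {ξ : Fin n → Ω → Y → ℝ}
    (hsupp : ∀ᵐ ω ∂P, ∀ i, x i ω ∈ γ.support) (h : IsSubGaussianNoiseModel P x ξ)
    (T : ℕ → Finset (X → Y)) {d : ℕ → ℝ} (hd : Tendsto d atTop (𝓝 0)) :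
    IsChainContinuousNoise γ P x ξ T d := by
  obtain ⟨ε, -, -, -, hξ⟩ := h
  filter_upwards [hsupp] with ω hω G g _ hg i
  simp only [hξ]
  exact tendsto_const_nhds.inner (tendsto_of_forall_norm_sub_le hd fun k => hg k _ (hω i))

/-- Interchange of limits for a sequence of series that is uniformly summably Cauchy. -/
theorem tendsto_limUnder_of_summable_links {s : ℕ → ℕ → ℝ} {S l r : ℕ → ℝ} (hr : Summable r)
    (hlink : ∀ᶠ k in atTop, ∀ J, |s k J - s (k + 1) J| ≤ r k)
    (hS : ∀ J, Tendsto (fun k => s k J) atTop (𝓝 (S J)))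
    (hl : ∀ k, Tendsto (s k) atTop (𝓝 (l k))) : Tendsto l atTop (𝓝 (limUnder atTop S)) := by
  obtain ⟨k₀, hk₀⟩ := eventually_atTop.1 hlink
  have hr' : Summable fun k => r (k + k₀) := (summable_nat_add_iff k₀).2 hr
  have hlink' : ∀ k J, dist (s (k + k₀) J) (s (k.succ + k₀) J) ≤ r (k + k₀) := fun k J => by
    rw [Real.dist_eq, Nat.succ_add]; exact hk₀ _ (by omega) J
  -- The tails of the summable links bound the error uniformly in the truncation level `J`, which
  -- permits the interchange of limits.
  have hunif : TendstoUniformly (fun k => s (k + k₀)) S atTop := by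
    rw [Metric.tendstoUniformly_iff]
    intro e he
    have h0 : Tendsto (fun k => ∑' m, r (k + m + k₀)) atTop (𝓝 0) := by
      refine (tendsto_sum_nat_add fun k => r (k + k₀)).congr fun k => ?_
      exact tsum_congr fun m => by rw [add_comm m k]
    filter_upwards [h0.eventually_lt_const he] with k hk J
    rw [dist_comm]
    exact (dist_le_tsum_of_dist_le_of_tendsto _ (fun k => hlink' k J) hr'
      ((tendsto_add_atTop_iff_nat k₀).2 (hS J)) k).trans_lt hk
  have hc : CauchySeq fun k => l (k + k₀) :=
    cauchySeq_of_dist_le_of_summable _ (fun k => le_of_tendsto ((hl (k + k₀)).dist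
      (hl (k.succ + k₀))) (Eventually.of_forall fun J => hlink' k J)) hr'
  obtain ⟨L, hL⟩ := cauchySeq_tendsto_of_complete hc
  have := hunif.tendsto_of_eventually_tendsto (Eventually.of_forall fun k => hl (k + k₀)) hL
  rw [this.limUnder_eq]
  exact (tendsto_add_atTop_iff_nat k₀).1 hL

end Noise

/-! ### The white noise model -/

section WhiteNoiseModel

variable {Ω X Y : Type*} [MeasurableSpace Ω] {P : Measure Ω} [IsProbabilityMeasure P]
  [TopologicalSpace X] [MeasurableSpace X]
  [NormedAddCommGroup Y] [InnerProductSpace ℝ Y]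

/-- The partial sums of the canonical version of a white noise path. -/
noncomputable def whiteNoisePartialSum (ψ : ℕ → Y) (w : Y → ℝ) (v : Y) (J : ℕ) : ℝ :=
  ∑ j ∈ Finset.range J, inner ℝ (ψ j) v * w (ψ j)

theorem whiteNoisePartialSum_sub (ψ : ℕ → Y) (w : Y → ℝ) (u v : Y) (J : ℕ) :
    whiteNoisePartialSum ψ w (u - v) J =
      whiteNoisePartialSum ψ w u J - whiteNoisePartialSum ψ w v J := by
  simp [whiteNoisePartialSum, inner_sub_right, sub_mul]

theorem continuous_whiteNoisePartialSum (ψ : ℕ → Y) (w : Y → ℝ) (J : ℕ) :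
    Continuous fun v => whiteNoisePartialSum ψ w v J := by
  unfold whiteNoisePartialSum
  fun_prop

omit [TopologicalSpace X] in
theorem measurable_whiteNoisePartialSum [MeasurableSpace Y] [BorelSpace Y]
    [SecondCountableTopology Y] (ψ : ℕ → Y) {f : X → Y} (hf : Measurable f) (J : ℕ) :
    Measurable fun p : X × (Y → ℝ) => whiteNoisePartialSum ψ p.2 (f p.1) J := by
  unfold whiteNoisePartialSum
  refine Finset.measurable_sum _ fun j _ => Measurable.mul ?_ ?_
  · exact measurable_const.inner (hf.comp measurable_fst)
  · exact (measurable_pi_apply (ψ j)).comp measurable_snd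

variable [MeasurableSpace Y] [BorelSpace Y] [SecondCountableTopology Y]
  {ψ : ℕ → Y} {W : Y → Ω → ℝ} {x : Ω → X}

-- The series converges almost surely at each fixed vector. Independence carries this to the random
-- vector `f (x ω)` by Fubini, so the `limUnder` there is a true limit and not a default value.
omit [TopologicalSpace X] in
theorem IsGaussianWhiteNoise.ae_tendsto_whiteNoisePairing (hW : IsGaussianWhiteNoise P W)
    (hψ : IsOrthonormalSequenceBasis ψ) (hx : Measurable x)
    (hxW : IndepFun x (fun ω y => W y ω) P) {f : X → Y} (hf : Measurable f) :
    ∀ᵐ ω ∂P, Tendsto (fun J => whiteNoisePartialSum ψ (fun y => W y ω) (f (x ω)) J) atTop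
      (𝓝 (whiteNoisePairing ψ (fun y => W y ω) (f (x ω)))) := by
  have hS : MeasurableSet {p : X × (Y → ℝ) | ∃ l : ℝ, Tendsto
      (fun J => whiteNoisePartialSum ψ p.2 (f p.1) J) atTop (𝓝 l)} :=
    measurableSet_exists_tendsto fun J => measurable_whiteNoisePartialSum ψ hf J
  have h := hxW.measure_le_of_forall_measure_le hx (measurable_pi_lambda _ hW.measurable)
    hS.compl (c := 0) (ae_of_all _ fun ω => (hW.ae_exists_tendsto hψ (f (x ω))).le)
  have h' : ∀ᵐ ω ∂P, ∃ l : ℝ, Tendsto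
      (fun J => whiteNoisePartialSum ψ (fun y => W y ω) (f (x ω)) J) atTop (𝓝 l) :=
    le_antisymm h zero_le
  filter_upwards [h'] with ω hω
  exact tendsto_nhds_limUnder hω

/-- The maximal inequality at a random vector that is bounded and independent of the noise. -/
theorem IsGaussianWhiteNoise.measure_exists_le_random {γ : Measure X}
    (hW : IsGaussianWhiteNoise P W) (hψ : IsOrthonormalSequenceBasis ψ) (hx : Measurable x)
    (hsupp : ∀ᵐ ω ∂P, x ω ∈ γ.support)
    (hxW : IndepFun x (fun ω y => W y ω) P) {f : X → Y} (hf : Measurable f) {d : ℝ} (hd : 0 < d)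
    (hfd : ∀ a ∈ γ.support, ‖f a‖ ≤ d) {r : ℝ} (hr : 0 < r) :
    P {ω | ∃ J, r ≤ |whiteNoisePartialSum ψ (fun y => W y ω) (f (x ω)) J|} ≤
      ENNReal.ofReal (2 * Real.exp (-(r ^ 2 / (2 * d ^ 2)))) := by
  have hS : MeasurableSet {p : X × (Y → ℝ) | ∃ J, r ≤ |whiteNoisePartialSum ψ p.2 (f p.1) J|} := by
    rw [Set.ofPred_exists]
    exact MeasurableSet.iUnion fun J => measurableSet_le measurable_const
      (measurable_whiteNoisePartialSum ψ hf J).abs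
  refine hxW.measure_le_of_forall_measure_le hx (measurable_pi_lambda _ hW.measurable) hS ?_
  filter_upwards [hsupp] with ω hω
  exact hW.measure_exists_le hψ (f (x ω)) hd (hfd _ hω) hr

-- The exponential bound holds for every truncation of the series with the same constant, and
-- Fatou's lemma passes it to the limit.
omit [TopologicalSpace X] in
theorem IsWhiteNoiseModel.isSubGaussianNoise {n : ℕ} {x : Fin n → Ω → X}
    {ξ : Fin n → Ω → Y → ℝ} (hx : ∀ i, Measurable (x i)) (h : IsWhiteNoiseModel P x ξ) :
    IsSubGaussianNoise P x ξ := by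
  obtain ⟨ψ, W, hψ, hW, hind, hxW, hξ⟩ := h
  have hWm : ∀ i, Measurable fun ω y => W i y ω := fun i =>
    measurable_pi_lambda _ (hW i).measurable
  have hxWi : ∀ i, IndepFun (x i) (fun ω y => W i y ω) P := fun i =>
    hxW.comp (measurable_pi_apply i) (measurable_pi_apply i)
  have hlim : ∀ G : X → Y, Measurable G → ∀ i, ∀ᵐ ω ∂P, Tendsto
      (fun J => whiteNoisePartialSum ψ (fun y => W i y ω) (G (x i ω)) J) atTop
      (𝓝 (ξ i ω (G (x i ω)))) := fun G hG i => by
    simp only [hξ]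
    exact (hW i).ae_tendsto_whiteNoisePairing hψ (hx i) (hxWi i) hG
  have hmeas : ∀ G : X → Y, Measurable G → ∀ i J, Measurable fun ω =>
      whiteNoisePartialSum ψ (fun y => W i y ω) (G (x i ω)) J := fun G hG i J =>
    (measurable_whiteNoisePartialSum ψ hG J).comp ((hx i).prodMk (hWm i))
  refine ⟨fun G hG i => aemeasurable_of_tendsto_metrizable_ae atTop
    (fun J => (hmeas G hG i J).aemeasurable) (hlim G hG i), fun G G' hG hG' t => ?_⟩
  let F : ℕ → Ω → ℝ≥0∞ := fun J ω => ENNReal.ofReal (Real.exp (t * ∑ i,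
    (whiteNoisePartialSum ψ (fun y => W i y ω) (G (x i ω)) J -
      whiteNoisePartialSum ψ (fun y => W i y ω) (G' (x i ω)) J) -
    noiseProxy * (t ^ 2 * ∑ i, ‖G (x i ω) - G' (x i ω)‖ ^ 2)))
  have hFm : ∀ J, Measurable (F J) := fun J => by
    refine (((Finset.measurable_sum _ fun i _ => (hmeas G hG i J).sub
      (hmeas G' hG' i J)).const_mul t).sub (((Finset.measurable_sum _ fun i _ =>
        ?_).const_mul _).const_mul _)).exp.ennreal_ofReal
    exact ((hG.comp (hx i)).sub (hG'.comp (hx i))).norm.pow_const 2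
  have hF1 : ∀ J, ∫⁻ ω, F J ω ∂P ≤ 1 := fun J => by
    have hφ : Measurable (Function.uncurry fun (a : X) (w : Y → ℝ) => ENNReal.ofReal (Real.exp
        (t * whiteNoisePartialSum ψ w (G a - G' a) J
          - noiseProxy * (t ^ 2 * ‖G a - G' a‖ ^ 2)))) := by
      have h1 : Measurable fun a : X => G a - G' a := hG.sub hG'
      exact (((measurable_whiteNoisePartialSum ψ h1 J).const_mul t).sub
        ((((h1.comp measurable_fst).norm.pow_const 2).const_mul _).const_mul _)).exp.ennreal_ofReal
    refine le_of_eq_of_le ?_ (lintegral_prod_le_one hx hWm hind hxW hφ fun a i => ?_)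
    · refine lintegral_congr fun ω => ?_
      simp only [F]
      rw [prod_ofReal_exp_sum]
      simp only [whiteNoisePartialSum_sub]
    · refine le_trans (lintegral_mono fun ω => ENNReal.ofReal_le_ofReal (Real.exp_le_exp.2 ?_))
        ((hW i).lintegral_exp_le hψ (G a - G' a) J t)
      simp only [whiteNoisePartialSum]
      have : 0 ≤ t ^ 2 * ‖G a - G' a‖ ^ 2 := by positivity
      nlinarith [one_le_noiseProxy]
  have hFlim : ∀ᵐ ω ∂P, ENNReal.ofReal (Real.exp (t * ∑ i, (ξ i ω (G (x i ω)) -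
      ξ i ω (G' (x i ω))) - noiseProxy * (t ^ 2 * ∑ i, ‖G (x i ω) - G' (x i ω)‖ ^ 2))) =
      liminf (fun J => F J ω) atTop := by
    filter_upwards [ae_all_iff.2 (hlim G hG), ae_all_iff.2 (hlim G' hG')] with ω h1 h2
    refine (Tendsto.liminf_eq ?_).symm
    refine ENNReal.tendsto_ofReal ((Real.continuous_exp.tendsto _).comp ?_)
    exact ((tendsto_finsetSum _ fun i _ => (h1 i).sub (h2 i)).const_mul t).sub_const _
  rw [lintegral_congr_ae hFlim]
  refine (lintegral_liminf_le hFm).trans ?_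
  exact liminf_le_of_le (by isBoundedDefault) fun b hb =>
    let ⟨J, hJ⟩ := hb.exists; hJ.trans (hF1 J)

/-- The exceptional set must not depend on `G`, since `G` will be the noise-dependent minimizer.
Only the countably many links between consecutive finite sets are controlled. Borel–Cantelli then
makes the increments along any admissible chain eventually summable, uniformly in the truncation
level. -/
theorem IsWhiteNoiseModel.isChainContinuousNoise {n : ℕ}
    {γ : Measure X} {x : Fin n → Ω → X} {ξ : Fin n → Ω → Y → ℝ} (hx : ∀ i, Measurable (x i))
    (hsupp : ∀ᵐ ω ∂P, ∀ i, x i ω ∈ γ.support) (h : IsWhiteNoiseModel P x ξ)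
    (T : ℕ → Finset (X → Y)) (hT : ∀ k, ∀ g ∈ T k, Measurable g) {d h : ℕ → ℝ}
    (hd : Tendsto d atTop (𝓝 0)) (hd0 : ∀ k, 0 < d k) (hanti : Antitone d)
    (hh : ∀ k, 0 ≤ h k) (hcard : ∀ k, ((T k).card * (T (k + 1)).card : ℝ) ≤ Real.exp (h k))
    (hsum : Summable fun k => d k * √(h k + k + 1)) :
    IsChainContinuousNoise γ P x ξ T d := by
  classical
  rename IsWhiteNoiseModel P x ξ => hmodel
  obtain ⟨ψ, W, hψ, hW, hind, hxW, hξ⟩ := hmodel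
  have hxWi : ∀ i, IndepFun (x i) (fun ω y => W i y ω) P := fun i =>
    hxW.comp (measurable_pi_apply i) (measurable_pi_apply i)
  have hlim : ∀ᵐ ω ∂P, ∀ i k, ∀ g ∈ T k, Tendsto
      (fun J => whiteNoisePartialSum ψ (fun y => W i y ω) (g (x i ω)) J) atTop
      (𝓝 (whiteNoisePairing ψ (fun y => W i y ω) (g (x i ω)))) := by
    refine ae_all_iff.2 fun i => ae_all_iff.2 fun k => ?_
    refine (ae_ball_iff (T k).countable_toSet).2 fun g hg => ?_
    exact (hW i).ae_tendsto_whiteNoisePairing hψ (hx i) (hxWi i) (hT k g hg)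
  -- the deviations allowed for the links of level `k`
  let r : ℕ → ℝ := fun k => √8 * (d k * √(h k + k + 1))
  have hr0 : ∀ k, 0 < r k := fun k => by
    have := hh k; have := hd0 k
    have : 0 < h k + k + 1 := by positivity
    positivity
  -- The factor `√8` matches `2 * (2 * d k) ^ 2`. In the resulting tail exponent, `h k` pays for the
  -- number of pairs and `k` makes the probabilities summable.
  have hr2 : ∀ k, r k ^ 2 / (2 * (2 * d k) ^ 2) = h k + k + 1 := fun k => by
    have h1 := hh k
    have h2 := (hd0 k).ne'
    have h3 : 0 ≤ h k + k + 1 := by positivity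
    simp only [r]
    rw [mul_pow, mul_pow, Real.sq_sqrt (by norm_num), Real.sq_sqrt h3]
    field_simp
    ring
  let links : ℕ → Finset ((X → Y) × (X → Y)) := fun k =>
    (T k ×ˢ T (k + 1)).filter fun p => ∀ a ∈ γ.support, ‖p.1 a - p.2 a‖ ≤ 2 * d k
  let bad : Fin n → ℕ → Set Ω := fun i k => ⋃ p ∈ links k, {ω | ∃ J, r k ≤
    |whiteNoisePartialSum ψ (fun y => W i y ω) ((p.1 - p.2) (x i ω)) J|}
  have hbad : ∀ i k, P (bad i k) ≤ ENNReal.ofReal (2 * Real.exp (-1) ^ k) := by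
    intro i k
    have h1 : ∀ p ∈ links k, P {ω | ∃ J, r k ≤
        |whiteNoisePartialSum ψ (fun y => W i y ω) ((p.1 - p.2) (x i ω)) J|} ≤
        ENNReal.ofReal (2 * Real.exp (-(h k + k + 1))) := by
      intro p hp
      obtain ⟨hp1, hp2⟩ := Finset.mem_filter.1 hp
      obtain ⟨hp1, hp3⟩ := Finset.mem_product.1 hp1
      rw [← hr2 k]
      exact (hW i).measure_exists_le_random hψ (hx i) (hsupp.mono fun ω h => h i) (hxWi i)
        ((hT k _ hp1).sub (hT _ _ hp3)) (by have := hd0 k; positivity) hp2 (hr0 k)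
    refine (measure_biUnion_finset_le _ _).trans ((Finset.sum_le_sum h1).trans ?_)
    rw [Finset.sum_const, nsmul_eq_mul, ← ENNReal.ofReal_natCast,
      ← ENNReal.ofReal_mul (Nat.cast_nonneg _)]
    refine ENNReal.ofReal_le_ofReal ?_
    have h2 : ((links k).card : ℝ) ≤ Real.exp (h k) := by
      refine le_trans ?_ (hcard k)
      have := Finset.card_filter_le (T k ×ˢ T (k + 1))
        fun p => ∀ a ∈ γ.support, ‖p.1 a - p.2 a‖ ≤ 2 * d k
      rw [Finset.card_product] at this
      exact_mod_cast this
    calc ((links k).card : ℝ) * (2 * Real.exp (-(h k + k + 1)))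
        ≤ Real.exp (h k) * (2 * Real.exp (-(h k + k + 1))) := by gcongr
      _ = 2 * Real.exp (-(k : ℝ) - 1) := by
        rw [mul_left_comm, ← Real.exp_add]; congr 2; ring
      _ ≤ 2 * Real.exp (-(k : ℝ)) := by gcongr; linarith
      _ = _ := by rw [← Real.exp_nat_mul]; congr 2; ring
  have hBC : ∀ᵐ ω ∂P, ∀ i, ∀ᶠ k in atTop, ω ∉ bad i k := by
    refine ae_all_iff.2 fun i => ?_
    refine ae_eventually_notMem (ne_top_of_le_ne_top ?_ (ENNReal.tsum_le_tsum (hbad i)))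
    have hlt : Real.exp (-1) < 1 := (Real.exp_lt_exp.2 (by norm_num)).trans_eq Real.exp_zero
    exact ((summable_geometric_of_lt_one (Real.exp_pos _).le hlt).mul_left 2).tsum_ofReal_ne_top
  filter_upwards [hsupp, hlim, hBC] with ω hω hl hb G g hg hGg i
  have key := tendsto_limUnder_of_summable_links (hsum.mul_left √8)
    (s := fun k J => whiteNoisePartialSum ψ (fun y => W i y ω) (g k (x i ω)) J)
    (S := fun J => whiteNoisePartialSum ψ (fun y => W i y ω) (G (x i ω)) J)
    (l := fun k => whiteNoisePairing ψ (fun y => W i y ω) (g k (x i ω))) ?_ ?_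
    (fun k => hl i k (g k) (hg k))
  · simp only [hξ]
    exact key
  · filter_upwards [hb i] with k hk J
    rw [← whiteNoisePartialSum_sub]
    by_contra hcon
    refine hk (Set.mem_biUnion (x := (g k, g (k + 1))) ?_ ⟨J, (not_le.1 hcon).le⟩)
    refine Finset.mem_coe.2 (Finset.mem_filter.2
      ⟨Finset.mem_product.2 ⟨hg k, hg (k + 1)⟩, fun a ha => ?_⟩)
    have h1 := hGg k a ha
    have h2 := hGg (k + 1) a ha
    have h3 := hanti (Nat.le_succ k)
    have h4 : g k a - g (k + 1) a = (G a - g (k + 1) a) - (G a - g k a) := by abel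
    simp only [h4]
    refine (norm_sub_le _ _).trans ?_
    simp only [Nat.succ_eq_add_one] at h3
    linarith
  · intro J
    exact ((continuous_whiteNoisePartialSum ψ _ J).tendsto _).comp
      (tendsto_of_forall_norm_sub_le hd fun k => hGg k _ (hω i))

end WhiteNoiseModel

/-! ### Finite nets from metric entropy -/

section Nets

variable {X Y : Type*} [TopologicalSpace X] [MeasurableSpace X] [NormedAddCommGroup Y]

theorem edist_supRestrict_le_iff {γ : Measure X} {F G : X → Y} {δ : ℝ} (hδ : 0 ≤ δ) :
    edist (supRestrict γ F) (supRestrict γ G) ≤ ENNReal.ofReal δ ↔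
      ∀ a ∈ γ.support, ‖F a - G a‖ ≤ δ := by
  rw [UniformFun.edist_le]
  simp only [supRestrict, UniformFun.toFun_ofFun, edist_dist, dist_eq_norm, Subtype.forall,
    ENNReal.ofReal_le_ofReal_iff hδ]

/-- An entropy bound yields a finite net of controlled cardinality inside the class. -/
theorem exists_finset_net_of_supEntropy_le {γ : Measure X} {𝒢 : Set (X → Y)} {δ H : ℝ}
    (hδ : 0 < δ) (h : supEntropy γ 𝒢 δ ≤ (H : EReal)) :
    ∃ T : Finset (X → Y), ↑T ⊆ 𝒢 ∧ (T.card : ℝ) ≤ Real.exp H ∧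
      ∀ G ∈ 𝒢, ∃ g ∈ T, ∀ a ∈ γ.support, ‖G a - g a‖ ≤ δ := by
  classical
  have h1 : ((openCoveringNumber (supRestrict γ '' 𝒢) δ : ℕ∞) : ℝ≥0∞) ≤
      ENNReal.ofReal (Real.exp H) := by
    have h2 := EReal.exp_monotone h
    rwa [supEntropy, metricEntropy, ENNReal.exp_log, EReal.exp_coe] at h2
  have hne : openCoveringNumber (supRestrict γ '' 𝒢) δ ≠ ⊤ := by
    intro h0
    rw [h0] at h1
    simp at h1
  obtain ⟨S, hS⟩ := ENat.exists_eq_iInf fun S : Set (UniformFun γ.support Y) =>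
    ⨅ (_ : S ⊆ supRestrict γ '' 𝒢) (_ : supRestrict γ '' 𝒢 ⊆
      ⋃ c ∈ S, Metric.eball c (ENNReal.ofReal δ)), S.encard
  change _ = openCoveringNumber (supRestrict γ '' 𝒢) δ at hS
  -- A set violating either side condition contributes `⊤` to the infimum, which `hne` excludes.
  by_cases hS1 : S ⊆ supRestrict γ '' 𝒢
  swap
  · simp [hS1] at hS; exact absurd hS.symm hne
  by_cases hS2 : supRestrict γ '' 𝒢 ⊆ ⋃ c ∈ S, Metric.eball c (ENNReal.ofReal δ)
  swap
  · simp [hS1, hS2] at hS; exact absurd hS.symm hne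
  simp only [hS1, hS2, iInf_pos] at hS
  have hfin : S.Finite := Set.encard_ne_top_iff.1 (hS ▸ hne)
  have hS3 : ∀ c ∈ S, ∃ G, G ∈ 𝒢 ∧ supRestrict γ G = c := fun c hc => hS1 hc
  choose! f hf𝒢 hfS using hS3
  refine ⟨hfin.toFinset.image f, ?_, ?_, ?_⟩
  · intro g hg
    obtain ⟨c, hc, rfl⟩ := Finset.mem_image.1 (Finset.mem_coe.1 hg)
    exact hf𝒢 c (hfin.mem_toFinset.1 hc)
  · refine le_trans (Nat.cast_le.2 Finset.card_image_le) ?_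
    rw [← hS, hfin.encard_eq_coe_toFinset_card] at h1
    rw [← ENNReal.ofReal_le_ofReal_iff (Real.exp_pos _).le]
    simpa using h1
  · intro G hG
    obtain ⟨c, hc, hcG⟩ := Set.mem_iUnion₂.1 (hS2 ⟨G, hG, rfl⟩)
    refine ⟨f c, Finset.mem_image_of_mem _ (hfin.mem_toFinset.2 hc), ?_⟩
    rw [← edist_supRestrict_le_iff hδ.le, hfS c hc]
    exact (Metric.mem_eball.1 hcG).le

end Nets

/-! ### Risk bounds by chaining -/

section Expectation

variable {Ω : Type*} [MeasurableSpace Ω] {P : Measure Ω}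

/-- Finitely many variables with exponential moments at most one are simultaneously bounded by the
logarithm of their number, up to a remainder with mean at most one. -/
theorem exists_remainder_of_lintegral_exp_le {ι : Type*} (s : Finset ι) {Z : ι → Ω → ℝ} {h : ℝ}
    (hcard : (s.card : ℝ) ≤ Real.exp h)
    (hZ : ∀ i ∈ s, AEMeasurable (Z i) P)
    (hexp : ∀ i ∈ s, ∫⁻ ω, ENNReal.ofReal (Real.exp (Z i ω)) ∂P ≤ 1) :
    ∃ R : Ω → ℝ≥0∞, AEMeasurable R P ∧ ∫⁻ ω, R ω ∂P ≤ 1 ∧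
      ∀ ω, ∀ i ∈ s, ENNReal.ofReal (Z i ω) ≤ ENNReal.ofReal h + R ω := by
  have hm : ∀ i ∈ s, AEMeasurable (fun ω => ENNReal.ofReal (Real.exp (Z i ω))) P :=
    fun i hi => (hZ i hi).exp.ennreal_ofReal
  refine ⟨fun ω => (∑ i ∈ s, ENNReal.ofReal (Real.exp (Z i ω))) * ENNReal.ofReal (Real.exp (-h)),
    (Finset.aemeasurable_fun_sum s hm).mul_const _, ?_, fun ω i hi => ?_⟩
  · rw [lintegral_mul_const'' _ (Finset.aemeasurable_fun_sum s hm), lintegral_finsetSum' s hm]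
    calc _ ≤ (∑ i ∈ s, 1) * ENNReal.ofReal (Real.exp (-h)) := by
          gcongr with i hi; exact hexp i hi
      _ = ENNReal.ofReal (s.card * Real.exp (-h)) := by
          rw [ENNReal.ofReal_mul (Nat.cast_nonneg _), ENNReal.ofReal_natCast]; simp
      _ ≤ ENNReal.ofReal (Real.exp h * Real.exp (-h)) := by gcongr
      _ = 1 := by rw [← Real.exp_add]; simp
  -- Linearizing at `h` replaces the maximum over `s` by a sum of exponentials, whose mean is at
  -- most card · exp(-h) ≤ 1.
  · have h1 : Z i ω ≤ h + Real.exp (Z i ω - h) := by linarith [Real.add_one_le_exp (Z i ω - h)]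
    refine (ENNReal.ofReal_le_ofReal h1).trans (ENNReal.ofReal_add_le.trans (add_le_add_right ?_ _))
    rw [sub_eq_add_neg, Real.exp_add, ENNReal.ofReal_mul (Real.exp_pos _).le]
    beta_reduce
    gcongr
    exact Finset.single_le_sum (f := fun i => ENNReal.ofReal (Real.exp (Z i ω)))
      (fun _ _ => zero_le) hi

end Expectation

/-! ### Lower isometry for i.i.d. designs -/

section Design

variable {Ω X Y : Type*} [MeasurableSpace Ω] {P : Measure Ω} [IsProbabilityMeasure P]
  [TopologicalSpace X] [MeasurableSpace X] {γ : Measure X} [IsProbabilityMeasure γ]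
  {n : ℕ} {x : Fin n → Ω → X}

omit [TopologicalSpace X] [IsProbabilityMeasure P] [IsProbabilityMeasure γ] in
theorem IsIIDDesign.lintegral_comp (hx : IsIIDDesign γ P x) {f : X → ℝ≥0∞} (hf : Measurable f)
    (i : Fin n) : ∫⁻ ω, f (x i ω) ∂P = ∫⁻ a, f a ∂γ := by
  rw [← hx.law i, lintegral_map hf (hx.measurable i)]

omit [IsProbabilityMeasure P] [IsProbabilityMeasure γ] in
theorem IsIIDDesign.ae_mem_support (hx : IsIIDDesign γ P x) (hγ : γ.support ∈ ae γ) :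
    ∀ᵐ ω ∂P, ∀ i, x i ω ∈ γ.support := by
  refine ae_all_iff.2 fun i => ?_
  refine ae_of_ae_map (hx.measurable i).aemeasurable ?_
  rw [hx.law i]
  exact hγ

/-- The exponential lies below its chord between -1 and 0, and exp(-1) ≤ 1/2. -/
theorem Real.exp_neg_le_one_sub_half {u : ℝ} (h0 : 0 ≤ u) (h1 : u ≤ 1) :
    Real.exp (-u) ≤ 1 - u / 2 := by
  have hc := convexOn_exp.2 (Set.mem_univ 0) (Set.mem_univ (-1))
    (by linarith : 0 ≤ 1 - u) h0 (by ring)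
  simp only [smul_eq_mul, mul_zero, zero_add, Real.exp_zero, mul_one, mul_neg] at hc
  have he : Real.exp (-1) ≤ 1 / 2 := by
    rw [Real.exp_neg, one_div]
    exact inv_anti₀ (by norm_num) (by linarith [Real.exp_one_gt_d9])
  nlinarith

omit [TopologicalSpace X] [IsProbabilityMeasure P] in
/-- The lower tail of an empirical mean of bounded nonnegative variables, relative to its
expectation. -/
theorem IsIIDDesign.lintegral_exp_half_mean_sub_le (hx : IsIIDDesign γ P x) {Z : X → ℝ} {B : ℝ}
    (hZ : Measurable Z) (hB : 0 < B) (hZ0 : ∀ a, 0 ≤ Z a) (hZB : ∀ᵐ a ∂γ, Z a ≤ B) :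
    ∫⁻ ω, ENNReal.ofReal (Real.exp ((n * (∫ a, Z a ∂γ) / 2 - ∑ i, Z (x i ω)) / B)) ∂P ≤ 1 := by
  set q := ∫ a, Z a ∂γ with hq
  let f : X → ℝ≥0∞ := fun a => ENNReal.ofReal (Real.exp ((q / 2 - Z a) / B))
  have hf : Measurable f := ((hZ.const_sub _).div_const _).exp.ennreal_ofReal
  have hZint : Integrable Z γ := by
    refine (integrable_const B).mono' hZ.aestronglyMeasurable ?_
    filter_upwards [hZB] with a ha
    rwa [Real.norm_of_nonneg (hZ0 a)]
  have h1 : ∫⁻ a, f a ∂γ ≤ 1 := by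
    have hint : Integrable (fun a => Real.exp (q / 2 / B) * (1 - Z a / B / 2)) γ :=
      ((integrable_const _).sub ((hZint.div_const B).div_const 2)).const_mul _
    have hle : ∀ᵐ a ∂γ, f a ≤ ENNReal.ofReal (Real.exp (q / 2 / B) * (1 - Z a / B / 2)) := by
      filter_upwards [hZB] with a ha
      refine ENNReal.ofReal_le_ofReal ?_
      rw [sub_div, sub_eq_add_neg, Real.exp_add]
      gcongr
      exact Real.exp_neg_le_one_sub_half (div_nonneg (hZ0 a) hB.le) ((div_le_one hB).2 ha)
    refine (lintegral_mono_ae hle).trans ?_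
    rw [← ofReal_integral_eq_lintegral_ofReal hint, ENNReal.ofReal_le_one, integral_const_mul,
      integral_sub (integrable_const _) ((hZint.div_const B).div_const 2), integral_div,
      integral_div, ← hq]
    · simp only [integral_const, probReal_univ, one_smul]
      have h2 : 1 - q / B / 2 ≤ Real.exp (-(q / 2 / B)) := by
        refine le_trans (le_of_eq ?_) (Real.add_one_le_exp _)
        ring
      calc _ ≤ Real.exp (q / 2 / B) * Real.exp (-(q / 2 / B)) := by gcongr
        _ = 1 := by rw [← Real.exp_add]; simp
    · filter_upwards [hZB] with a ha
      have := (div_le_one hB).2 ha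
      exact mul_nonneg (Real.exp_pos _).le (by linarith)
  have h2 : ∀ ω, ENNReal.ofReal (Real.exp ((n * q / 2 - ∑ i, Z (x i ω)) / B)) =
      ∏ i, f (x i ω) := fun ω => by
    simp only [f]
    rw [← ENNReal.ofReal_prod_of_nonneg fun _ _ => (Real.exp_pos _).le, ← Real.exp_sum,
      ← Finset.sum_div, Finset.sum_sub_distrib]
    simp only [Finset.sum_const, Finset.card_univ, Fintype.card_fin, nsmul_eq_mul]
    congr 4; ring
  simp only [h2]
  have hI : iIndepFun (fun i ω => f (x i ω)) P := hx.indep.comp (fun _ => f) fun _ => hf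
  rw [lintegral_prod_eq_prod_lintegral_of_indepFun Finset.univ _ hI
    fun i => hf.comp (hx.measurable i)]
  exact Finset.prod_le_one' fun i _ => (hx.lintegral_comp hf i).trans_le h1

end Design

/-! ### Basic inequality and elementary comparisons of squared errors -/

section Risk

variable {X Y : Type*} [NormedAddCommGroup Y]

/-- The basic inequality for empirical risk minimizers. -/
theorem sum_norm_sub_sq_le_of_empiricalRisk_le [InnerProductSpace ℝ Y] {n : ℕ} (hn : 1 ≤ n) {G₀ G G' : X → Y} {σ : ℝ}
    {x : Fin n → X} {e : Fin n → Y → ℝ}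
    (h : empiricalRisk x (fun i => observation G₀ σ (x i) (e i)) G ≤
      empiricalRisk x (fun i => observation G₀ σ (x i) (e i)) G') :
    ∑ i, ‖G (x i) - G₀ (x i)‖ ^ 2 ≤ ∑ i, ‖G' (x i) - G₀ (x i)‖ ^ 2 +
      2 * σ * ∑ i, (e i (G (x i)) - e i (G' (x i))) := by
  have hn' : (0 : ℝ) < 1 / n := by
    have : (0 : ℝ) < n := by exact_mod_cast hn
    positivity
  have h1 := le_of_mul_le_mul_left h hn'
  -- Completing the square: up to a term free of `F`, the squared error is the risk sum plus the
  -- noise.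
  have key : ∀ F : X → Y, ∑ i, ‖F (x i) - G₀ (x i)‖ ^ 2 =
      ∑ i, (-2 * observation G₀ σ (x i) (e i) (F (x i)) + ‖F (x i)‖ ^ 2) +
        ∑ i, ‖G₀ (x i)‖ ^ 2 + 2 * σ * ∑ i, e i (F (x i)) := fun F => by
    rw [Finset.mul_sum, ← Finset.sum_add_distrib, ← Finset.sum_add_distrib]
    refine Finset.sum_congr rfl fun i _ => ?_
    rw [norm_sub_sq_real, observation, real_inner_comm]
    ring
  rw [key G, key G', Finset.sum_sub_distrib]
  linarith

theorem norm_sub_sq_le_two {u v w : Y} {δ : ℝ} (h : ‖u - v‖ ≤ δ) :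
    ‖u - w‖ ^ 2 ≤ 2 * ‖v - w‖ ^ 2 + 2 * δ ^ 2 := by
  have h1 : ‖u - w‖ ≤ ‖u - v‖ + ‖v - w‖ := norm_sub_le_norm_sub_add_norm_sub u v w
  have h2 : ‖u - w‖ ≤ δ + ‖v - w‖ := h1.trans (by gcongr)
  have h3 : ‖u - w‖ ^ 2 ≤ (δ + ‖v - w‖) ^ 2 := by gcongr
  nlinarith [sq_nonneg (δ - ‖v - w‖)]

theorem norm_sub_sq_le_three {u v w z : Y} {δ : ℝ} (h : ‖u - v‖ ≤ δ) :
    ‖v - z‖ ^ 2 ≤ 3 * δ ^ 2 + 3 * ‖u - w‖ ^ 2 + 3 * ‖z - w‖ ^ 2 := by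
  have h1 : v - z = -(u - v) + (u - w) - (z - w) := by abel
  have h2 : ‖v - z‖ ≤ δ + ‖u - w‖ + ‖z - w‖ := by
    rw [h1]
    refine (norm_sub_le _ _).trans ?_
    gcongr
    refine (norm_add_le _ _).trans ?_
    rw [norm_neg]
    gcongr
  have h3 : ‖v - z‖ ^ 2 ≤ (δ + ‖u - w‖ + ‖z - w‖) ^ 2 := by gcongr
  nlinarith [sq_nonneg (δ - ‖u - w‖), sq_nonneg (δ - ‖z - w‖), sq_nonneg (‖u - w‖ - ‖z - w‖)]

variable [MeasurableSpace X]

theorem integrable_norm_sub_sq [TopologicalSpace X] [MeasurableSpace Y] [BorelSpace Y] [SecondCountableTopology Y]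
    {γ : Measure X} [IsProbabilityMeasure γ] (hγ : γ.support ∈ ae γ) {G G₀ : X → Y} {F : ℝ}
    (hG : Measurable G) (hG₀ : Measurable G₀) (hF : ∀ a ∈ γ.support, ‖G a - G₀ a‖ ≤ F) :
    Integrable (fun a => ‖G a - G₀ a‖ ^ 2) γ := by
  refine (integrable_const (F ^ 2)).mono'
    ((hG.sub hG₀).norm.pow_const 2).aestronglyMeasurable ?_
  filter_upwards [hγ] with a ha
  rw [Real.norm_of_nonneg (by positivity)]
  have := hF a ha
  gcongr

theorem l2DistSq_eq_ofReal_integral {γ : Measure X} {G G₀ : X → Y}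
    (h : Integrable (fun a => ‖G a - G₀ a‖ ^ 2) γ) :
    l2DistSq γ G G₀ = ENNReal.ofReal (∫ a, ‖G a - G₀ a‖ ^ 2 ∂γ) := by
  rw [ofReal_integral_eq_lintegral_ofReal h (ae_of_all _ fun _ => by positivity), l2DistSq]
  refine lintegral_congr fun a => ?_
  rw [ENNReal.ofReal_pow (norm_nonneg _), ofReal_norm]

theorem lintegral_add_le_of_le_one {Ω : Type*} [MeasurableSpace Ω] {P : Measure Ω}
    [IsProbabilityMeasure P] {R : Ω → ℝ≥0∞} (hR : ∫⁻ ω, R ω ∂P ≤ 1) (c : ℝ≥0∞) :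
    ∫⁻ ω, (c + R ω) ∂P ≤ c + 1 := by
  rw [lintegral_add_left measurable_const]
  simpa using add_le_add_right hR c

end Risk

/-! ### Risk bound along a chain of nets -/

section Oracle

variable {Ω X Y : Type*} [MeasurableSpace Ω] {P : Measure Ω} [IsProbabilityMeasure P]
  [TopologicalSpace X] [MeasurableSpace X] {γ : Measure X} [IsProbabilityMeasure γ]
  [NormedAddCommGroup Y] [InnerProductSpace ℝ Y] [MeasurableSpace Y] [BorelSpace Y]
  [SecondCountableTopology Y]

/-- The risk of an empirical risk minimizer, bounded along a chain of finite nets `T k` of the class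
with free parameters `lam k`. -/
theorem meanSquaredError_le_of_chain (hγ : γ.support ∈ ae γ) {G₀ : X → Y} (hG₀ : Measurable G₀)
    {𝒢 : Set (X → Y)} (h𝒢 : ∀ G ∈ 𝒢, Measurable G) {F : ℝ} (hF : 0 < F)
    (h𝒢F : ∀ G ∈ 𝒢, ∀ a ∈ γ.support, ‖G a - G₀ a‖ ≤ F) {σ : ℝ} (hσ : 0 < σ) {n : ℕ} (hn : 1 ≤ n)
    {x : Fin n → Ω → X} {ξ : Fin n → Ω → Y → ℝ} {Ĝ : Ω → X → Y}
    (hx : IsIIDDesign γ P x) (hξ : IsSubGaussianNoise P x ξ)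
    {T : ℕ → Finset (X → Y)} {d h lam : ℕ → ℝ} (hT𝒢 : ∀ k, ↑(T k) ⊆ 𝒢)
    (hTnet : ∀ k, ∀ G ∈ 𝒢, ∃ g ∈ T k, ∀ a ∈ γ.support, ‖G a - g a‖ ≤ d k)
    (hanti : Antitone d) (hcard₀ : ((T 0).card : ℝ) ≤ Real.exp (h 0))
    (hcard : ∀ k, ((T k).card * (T (k + 1)).card : ℝ) ≤ Real.exp (h k))
    (hcont : IsChainContinuousNoise γ P x ξ T d) (hlam : ∀ k, 0 < lam k)
    (hERM : IsMeasurableERM γ G₀ σ 𝒢 P x ξ Ĝ) {Gs : X → Y} (hGs : Gs ∈ 𝒢) :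
    ENNReal.ofReal n * meanSquaredError γ G₀ P Ĝ ≤
      ENNReal.ofReal 24 * (n * l2DistSq γ Gs G₀) + ENNReal.ofReal (18 * n * d 0 ^ 2) +
      ENNReal.ofReal (384 * σ ^ 2 * noiseProxy) * (ENNReal.ofReal (h 0) + 1) +
      ENNReal.ofReal (32 * σ) * ∑' k, (ENNReal.ofReal (lam k)⁻¹ * (ENNReal.ofReal (h k) + 1) +
        ENNReal.ofReal (4 * noiseProxy * lam k * n * d k ^ 2)) +
      ENNReal.ofReal (4 * F ^ 2) * (ENNReal.ofReal (h 0) + 1) := by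
  classical
  have hc : 0 < noiseProxy := by linarith [one_le_noiseProxy]
  set c := noiseProxy with hcdef
  have hsupp := hx.ae_mem_support hγ
  have hTm : ∀ k, ∀ g ∈ T k, Measurable g := fun k g hg => h𝒢 g (hT𝒢 k hg)
  have hdm : ∀ G G' : X → Y, Measurable G → Measurable G' → ∀ i,
      Measurable fun ω => ‖G (x i ω) - G' (x i ω)‖ ^ 2 := fun G G' hG hG' i =>
    ((hG.comp (hx.measurable i)).sub (hG'.comp (hx.measurable i))).norm.pow_const 2
  let M : (X → Y) → (X → Y) → Ω → ℝ := fun G G' ω =>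
    ∑ i, (ξ i ω (G (x i ω)) - ξ i ω (G' (x i ω)))
  let Q : (X → Y) → (X → Y) → Ω → ℝ := fun G G' ω => ∑ i, ‖G (x i ω) - G' (x i ω)‖ ^ 2
  let q : (X → Y) → ℝ := fun G => ∫ a, ‖G a - G₀ a‖ ^ 2 ∂γ
  have hMm : ∀ G G' : X → Y, Measurable G → Measurable G' → AEMeasurable (M G G') P :=
    fun G G' hG hG' => Finset.aemeasurable_fun_sum _ fun i _ =>
      (hξ.aemeasurable G hG i).sub (hξ.aemeasurable G' hG' i)
  have hQm : ∀ G G' : X → Y, Measurable G → Measurable G' → Measurable (Q G G') :=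
    fun G G' hG hG' => Finset.measurable_sum _ fun i _ => hdm G G' hG hG' i
  have hZm : ∀ t, ∀ G G' : X → Y, Measurable G → Measurable G' →
      AEMeasurable (fun ω => t * M G G' ω - c * (t ^ 2 * Q G G' ω)) P := fun t G G' hG hG' =>
    ((hMm G G' hG hG').const_mul t).sub
      (((hQm G G' hG hG').const_mul (t ^ 2)).const_mul c).aemeasurable
  have hint : ∀ G ∈ 𝒢, Integrable (fun a => ‖G a - G₀ a‖ ^ 2) γ := fun G hG =>
    integrable_norm_sub_sq hγ (h𝒢 G hG) hG₀ (h𝒢F G hG)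
  -- lower isometry on the net
  obtain ⟨RA, hRAm, hRA, hA⟩ := exists_remainder_of_lintegral_exp_le (P := P) (T 0)
    (Z := fun g ω => (n * q g / 2 - Q g G₀ ω) / F ^ 2) hcard₀
    (fun g hg => (((hQm g G₀ (hTm 0 g hg) hG₀).const_sub _).div_const _).aemeasurable)
    (fun g hg => hx.lintegral_exp_half_mean_sub_le
      (((hTm 0 g hg).sub hG₀).norm.pow_const 2) (by positivity) (fun _ => by positivity) (by
        filter_upwards [hγ] with a ha
        have := h𝒢F g (hT𝒢 0 hg) a ha
        gcongr))
  -- the noise on the net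
  set t₀ : ℝ := 1 / (12 * σ * c) with ht₀
  obtain ⟨RB, hRBm, hRB, hB⟩ := exists_remainder_of_lintegral_exp_le (P := P) (T 0)
    (Z := fun g ω => t₀ * M g Gs ω - c * (t₀ ^ 2 * Q g Gs ω)) hcard₀
    (fun g hg => hZm t₀ g Gs (hTm 0 g hg) (h𝒢 Gs hGs))
    (fun g hg => hξ.lintegral_exp_le g Gs (hTm 0 g hg) (h𝒢 Gs hGs) t₀)
  -- the noise on the links
  have hlink := fun k => exists_remainder_of_lintegral_exp_le (P := P) (T k ×ˢ T (k + 1))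
    (Z := fun p ω => lam k * M p.2 p.1 ω - c * (lam k ^ 2 * Q p.2 p.1 ω)) (h := h k)
    (by rw [Finset.card_product]; exact_mod_cast hcard k)
    (fun p hp => hZm (lam k) p.2 p.1 (hTm _ _ (Finset.mem_product.1 hp).2)
      (hTm _ _ (Finset.mem_product.1 hp).1))
    (fun p hp => hξ.lintegral_exp_le p.2 p.1 (hTm _ _ (Finset.mem_product.1 hp).2)
      (hTm _ _ (Finset.mem_product.1 hp).1) (lam k))
  choose R hRm hR hRb using hlink
  let D : ℕ → Ω → ℝ≥0∞ := fun k ω => ENNReal.ofReal (lam k)⁻¹ * (ENNReal.ofReal (h k) + R k ω) +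
    ENNReal.ofReal (4 * c * lam k * n * d k ^ 2)
  have hDm : ∀ k, AEMeasurable (D k) P := fun k =>
    (((hRm k).const_add _).const_mul _).add_const _
  have hD : ∀ k, ∫⁻ ω, D k ω ∂P ≤ ENNReal.ofReal (lam k)⁻¹ * (ENNReal.ofReal (h k) + 1) +
      ENNReal.ofReal (4 * c * lam k * n * d k ^ 2) := fun k => by
    rw [lintegral_add_right _ measurable_const, lintegral_const_mul'' _ ((hRm k).const_add _)]
    simp only [lintegral_const, measure_univ, mul_one]
    gcongr
    exact lintegral_add_le_of_le_one (hR k) _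
  have hpt : ∀ᵐ ω ∂P, ENNReal.ofReal n * l2DistSq γ (Ĝ ω) G₀ ≤
      ENNReal.ofReal 24 * ENNReal.ofReal (Q Gs G₀ ω) + ENNReal.ofReal (18 * n * d 0 ^ 2) +
      ENNReal.ofReal (384 * σ ^ 2 * c) * (ENNReal.ofReal (h 0) + RB ω) +
      ENNReal.ofReal (32 * σ) * ∑' k, D k ω +
      ENNReal.ofReal (4 * F ^ 2) * (ENNReal.ofReal (h 0) + RA ω) := by
    filter_upwards [hsupp, hERM.minimizes, hcont] with ω hω hmin hcontω
    obtain ⟨hĜ, hmin⟩ := hmin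
    set G := Ĝ ω with hGdef
    choose g hgT hgd using fun k => hTnet k G hĜ
    have hbasic : Q G G₀ ω ≤ Q Gs G₀ ω + 2 * σ * M G Gs ω :=
      sum_norm_sub_sq_le_of_empiricalRisk_le hn (hmin Gs hGs)
    have hMadd : ∀ G₁ G₂ G₃ : X → Y, M G₁ G₃ ω = M G₁ G₂ ω + M G₂ G₃ ω := fun G₁ G₂ G₃ => by
      simp only [M, ← Finset.sum_add_distrib, sub_add_sub_cancel]
    -- the chain
    have hchain : ENNReal.ofReal (M G (g 0) ω) ≤ ∑' k, D k ω := by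
      have hlimit : Tendsto (fun m => M (g m) (g 0) ω) atTop (𝓝 (M G (g 0) ω)) :=
        tendsto_finsetSum _ fun i _ => (hcontω G g hgT hgd i).sub_const _
      -- Chain continuity reduces the claim to finite chains, where the increments telescope.
      refine le_of_tendsto (ENNReal.tendsto_ofReal hlimit) (Eventually.of_forall fun m => ?_)
      have hstep : ∀ k, ENNReal.ofReal (M (g (k + 1)) (g k) ω) ≤ D k ω := fun k => by
        have h1 := hRb k ω (g k, g (k + 1)) (Finset.mem_product.2 ⟨hgT k, hgT (k + 1)⟩)
        simp only at h1
        have hQ : Q (g (k + 1)) (g k) ω ≤ n * (4 * d k ^ 2) := by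
          calc Q (g (k + 1)) (g k) ω ≤ ∑ _i : Fin n, 4 * d k ^ 2 := by
                refine Finset.sum_le_sum fun i _ => ?_
                have h2 := hgd k _ (hω i)
                have h3 := hgd (k + 1) _ (hω i)
                have h4 := hanti (Nat.le_succ k)
                have h5 : ‖g (k + 1) (x i ω) - g k (x i ω)‖ ≤ 2 * d k := by
                  have := norm_sub_le (G (x i ω) - g k (x i ω)) (G (x i ω) - g (k + 1) (x i ω))
                  rw [sub_sub_sub_cancel_left] at this
                  simp only [Nat.succ_eq_add_one] at h4
                  linarith
                calc _ ≤ (2 * d k) ^ 2 := by gcongr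
                  _ = _ := by ring
            _ = _ := by simp
        have hl := hlam k
        -- Chernoff form of the link bound: the free parameter trades the entropy cost against the
        -- variance cost.
        have h6 : M (g (k + 1)) (g k) ω ≤ (lam k)⁻¹ * (lam k * M (g (k + 1)) (g k) ω -
            c * (lam k ^ 2 * Q (g (k + 1)) (g k) ω)) + 4 * c * lam k * n * d k ^ 2 := by
          have e1 : (lam k)⁻¹ * (lam k * M (g (k + 1)) (g k) ω -
            c * (lam k ^ 2 * Q (g (k + 1)) (g k) ω)) =
            M (g (k + 1)) (g k) ω - c * lam k * Q (g (k + 1)) (g k) ω := by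
              field_simp
          rw [e1]
          have := mul_le_mul_of_nonneg_left hQ (by positivity : 0 ≤ c * lam k)
          linarith
        refine (ENNReal.ofReal_le_ofReal h6).trans (ENNReal.ofReal_add_le.trans ?_)
        rw [ENNReal.ofReal_mul (by positivity)]
        exact add_le_add (mul_le_mul' le_rfl h1) le_rfl
      have hsum : ENNReal.ofReal (M (g m) (g 0) ω) ≤ ∑ k ∈ Finset.range m, D k ω := by
        induction m with
        | zero => simp [M]
        | succ m ih =>
          rw [Finset.sum_range_succ, hMadd _ (g m), add_comm]
          exact ENNReal.ofReal_add_le.trans (add_le_add ih (hstep m))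
      exact hsum.trans (ENNReal.sum_le_tsum _)
    -- the deterministic comparison
    have hA' := hA ω (g 0) (hgT 0)
    have hB' := hB ω (g 0) (hgT 0)
    set ZA := (n * q (g 0) / 2 - Q (g 0) G₀ ω) / F ^ 2 with hZA
    set ZB := t₀ * M (g 0) Gs ω - c * (t₀ ^ 2 * Q (g 0) Gs ω) with hZB
    have eA : F ^ 2 * ZA = n * q (g 0) / 2 - Q (g 0) G₀ ω := by
      rw [hZA]; field_simp
    -- `t₀` is chosen to give the weight 1/6. By `hQ2` below, that penalty uses only half of `Q G
    -- G₀`, which the basic inequality can absorb.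
    have eB : 24 * σ ^ 2 * c * ZB = 2 * σ * M (g 0) Gs ω - Q (g 0) Gs ω / 6 := by
      rw [hZB, ht₀]; field_simp; ring
    have hq : n * q G ≤ 2 * (n * q (g 0)) + 2 * n * d 0 ^ 2 := by
      have h1 : q G ≤ 2 * q (g 0) + 2 * d 0 ^ 2 := by
        have hi := hint (g 0) (hT𝒢 0 (hgT 0))
        calc q G ≤ ∫ a, (2 * ‖g 0 a - G₀ a‖ ^ 2 + 2 * d 0 ^ 2) ∂γ := by
              refine integral_mono_ae (hint G hĜ) ((hi.const_mul 2).add (integrable_const _)) ?_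
              filter_upwards [hγ] with a ha
              exact norm_sub_sq_le_two (hgd 0 a ha)
          _ = _ := by
              rw [integral_add (hi.const_mul 2) (integrable_const _), integral_const_mul]
              simp [q]
      have := mul_le_mul_of_nonneg_left h1 (Nat.cast_nonneg (α := ℝ) n)
      linarith
    have hQ1 : Q (g 0) G₀ ω ≤ 2 * Q G G₀ ω + 2 * n * d 0 ^ 2 := by
      calc Q (g 0) G₀ ω ≤ ∑ i, (2 * ‖G (x i ω) - G₀ (x i ω)‖ ^ 2 + 2 * d 0 ^ 2) :=
            Finset.sum_le_sum fun i _ => norm_sub_sq_le_two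
              (by rw [norm_sub_rev]; exact hgd 0 _ (hω i))
        _ = _ := by
            rw [Finset.sum_add_distrib, ← Finset.mul_sum]; simp [Q]; ring
    have hQ2 : Q (g 0) Gs ω ≤ 3 * n * d 0 ^ 2 + 3 * Q G G₀ ω + 3 * Q Gs G₀ ω := by
      calc Q (g 0) Gs ω ≤ ∑ i, (3 * d 0 ^ 2 + 3 * ‖G (x i ω) - G₀ (x i ω)‖ ^ 2 +
            3 * ‖Gs (x i ω) - G₀ (x i ω)‖ ^ 2) :=
            Finset.sum_le_sum fun i _ => norm_sub_sq_le_three (hgd 0 _ (hω i))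
        _ = _ := by
            simp only [Q, Finset.sum_add_distrib, ← Finset.mul_sum, Finset.sum_const,
              Finset.card_univ, Fintype.card_fin, nsmul_eq_mul]
            ring
    have hM := hMadd G (g 0) Gs
    -- Absorption gives `Q G G₀ ≤ 3 Q Gs G₀ + 4σ M G (g 0) + 48σ²c ZB + n d₀²`, where `d₀ = d 0`.
    -- The isometry steps `hq`, `eA`, `hQ1` give `n q G ≤ 8 Q G G₀ + 4F² ZA + 10 n d₀²`.
    have hreal : n * q G ≤ 24 * Q Gs G₀ ω + 18 * n * d 0 ^ 2 + 384 * σ ^ 2 * c * ZB +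
        32 * σ * M G (g 0) ω + 4 * F ^ 2 * ZA := by
      rw [hM] at hbasic
      linarith
    rw [l2DistSq_eq_ofReal_integral (hint G hĜ), ← ENNReal.ofReal_mul (Nat.cast_nonneg _)]
    refine (ENNReal.ofReal_le_ofReal hreal).trans ?_
    refine ENNReal.ofReal_add_le.trans (add_le_add (ENNReal.ofReal_add_le.trans (add_le_add
      (ENNReal.ofReal_add_le.trans (add_le_add (ENNReal.ofReal_add_le.trans (add_le_add ?_ le_rfl))
        ?_)) ?_)) ?_)
    · rw [ENNReal.ofReal_mul (by norm_num)]
    · rw [ENNReal.ofReal_mul (by positivity)]; gcongr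
    · rw [ENNReal.ofReal_mul (by positivity)]; gcongr
    · rw [ENNReal.ofReal_mul (by positivity)]; gcongr
  -- taking expectations
  have hQE : ∫⁻ ω, ENNReal.ofReal (Q Gs G₀ ω) ∂P = n * l2DistSq γ Gs G₀ := by
    have hm : Measurable fun a => ‖Gs a - G₀ a‖ₑ ^ 2 := ((h𝒢 Gs hGs).sub hG₀).enorm.pow_const 2
    have h1 : ∀ ω, ENNReal.ofReal (Q Gs G₀ ω) = ∑ i, ‖Gs (x i ω) - G₀ (x i ω)‖ₑ ^ 2 := fun ω => by
      rw [ENNReal.ofReal_sum_of_nonneg fun _ _ => by positivity]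
      exact Finset.sum_congr rfl fun i _ => by
        rw [ENNReal.ofReal_pow (norm_nonneg _), ofReal_norm]
    simp only [h1]
    rw [lintegral_finsetSum (f := fun i ω => ‖Gs (x i ω) - G₀ (x i ω)‖ₑ ^ 2) _
      fun i _ => hm.comp (hx.measurable i)]
    simp only [fun i => hx.lintegral_comp hm i]
    simp [l2DistSq]
  -- The finite constant moves inside without any measurability of the loss; only the majorant has
  -- to be measurable.
  rw [meanSquaredError, ← lintegral_const_mul' _ _ ENNReal.ofReal_ne_top]
  refine (lintegral_mono_ae hpt).trans ?_
  rw [lintegral_add_right' _ ((hRAm.const_add _).const_mul _),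
    lintegral_add_right' _ ((AEMeasurable.tsum hDm).const_mul _),
    lintegral_add_right' _ ((hRBm.const_add _).const_mul _),
    lintegral_add_right _ measurable_const,
    lintegral_const_mul'' _ (hRAm.const_add _),
    lintegral_const_mul'' _ (AEMeasurable.tsum hDm),
    lintegral_const_mul'' _ (hRBm.const_add _),
    lintegral_const_mul _ (hQm Gs G₀ (h𝒢 Gs hGs) hG₀).ennreal_ofReal, hQE,
    lintegral_tsum hDm]
  simp only [lintegral_const, measure_univ, mul_one]
  gcongr
  · exact lintegral_add_le_of_le_one hRB _
  · exact hD _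
  · exact lintegral_add_le_of_le_one hRA _

end Oracle

/-! ### Risk under polynomial entropy -/

section EntropyRate

/-- The constant in the risk bound under polynomial entropy with exponent `a`. -/
noncomputable def riskConstant (σ F a : ℝ) : ℝ :=
  18 + 2304 * σ ^ 2 * noiseProxy +
    16 * σ * ((6 + 4 * noiseProxy) * (1 - √(2 ^ a) / 2)⁻¹) + 24 * F ^ 2

/-- This is the ratio of the chaining series: radii halve while square roots of entropies grow by
`√(2 ^ a)`. Convergence is what requires `a < 2`. -/
theorem sqrt_two_rpow_div_two_lt_one {a : ℝ} (ha2 : a < 2) : √((2 : ℝ) ^ a) / 2 < 1 := by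
  have h1 : (2 : ℝ) ^ a < 2 ^ 2 := by
    rw [← Real.rpow_two]
    exact Real.rpow_lt_rpow_of_exponent_lt (by norm_num) ha2
  have h2 : √((2 : ℝ) ^ a) < 2 := (Real.sqrt_lt' (by norm_num)).2 h1
  linarith

theorem riskConstant_pos {σ F a : ℝ} (hσ : 0 < σ) (ha2 : a < 2) : 0 < riskConstant σ F a := by
  have h1 := sqrt_two_rpow_div_two_lt_one ha2
  have h2 : 0 < (1 - √((2 : ℝ) ^ a) / 2)⁻¹ := inv_pos.2 (by linarith)
  have := one_le_noiseProxy
  unfold riskConstant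
  positivity

variable {Ω X Y : Type*} [MeasurableSpace Ω] {P : Measure Ω} [IsProbabilityMeasure P]
  [TopologicalSpace X] [MeasurableSpace X] {γ : Measure X} [IsProbabilityMeasure γ]
  [NormedAddCommGroup Y] [InnerProductSpace ℝ Y] [MeasurableSpace Y] [BorelSpace Y]
  [SecondCountableTopology Y] [CompleteSpace Y]

theorem dyadic_rpow_neg {δ : ℝ} (hδ : 0 < δ) (a : ℝ) (k : ℕ) :
    (δ * (1 / 2) ^ k) ^ (-a) = δ ^ (-a) * ((2 : ℝ) ^ a) ^ k := by
  rw [Real.mul_rpow hδ.le (by positivity), one_div, inv_pow, Real.inv_rpow (by positivity),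
    ← Real.rpow_neg (by positivity : (0 : ℝ) ≤ 2 ^ k), neg_neg, ← Real.rpow_natCast, ← Real.rpow_natCast,
    ← Real.rpow_mul (by norm_num), ← Real.rpow_mul (by norm_num), mul_comm a]

/-- Supplies the summable link deviations that chain continuity of white noise requires. -/
theorem summable_dyadic_mul_sqrt {δ B ρ : ℝ} (hδ : 0 < δ) (hB : 0 ≤ B) (hρ : 0 ≤ ρ)
    (hθ : √ρ / 2 < 1) :
    Summable fun k : ℕ => δ * (1 / 2) ^ k * √(B * ρ ^ k + k + 1) := by
  have h1 : Summable fun k : ℕ => δ * √B * (√ρ / 2) ^ k :=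
    (summable_geometric_of_lt_one (by positivity) hθ).mul_left _
  have h2 : Summable fun k : ℕ => δ * ((k : ℝ) ^ 1 * (1 / 2) ^ k + (1 / 2) ^ k) :=
    ((summable_pow_mul_geometric_of_norm_lt_one 1 (by norm_num)).add
      (summable_geometric_of_lt_one (by norm_num) (by norm_num))).mul_left _
  refine Summable.of_nonneg_of_le (fun k => by positivity) (fun k => ?_) (h1.add h2)
  have h3 : √(B * ρ ^ k + k + 1) ≤ √B * √ρ ^ k + (k + 1) := by
    rw [add_assoc]
    refine Real.sqrt_le_iff.2 ⟨by positivity, ?_⟩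
    have e1 : (√B * √ρ ^ k) ^ 2 = B * ρ ^ k := by
      rw [mul_pow, Real.sq_sqrt hB, ← pow_mul, mul_comm k 2, pow_mul, Real.sq_sqrt hρ]
    have h4 : 0 ≤ √B * √ρ ^ k := by positivity
    have h5 : (0 : ℝ) ≤ k := Nat.cast_nonneg k
    nlinarith [mul_nonneg h4 h5]
  refine (mul_le_mul_of_nonneg_left h3 (by positivity)).trans_eq ?_
  rw [div_pow, div_pow]
  ring

/-- The risk of an empirical risk minimizer over a class of polynomial entropy. -/
theorem meanSquaredError_le_of_entropy (hγ : γ.support ∈ ae γ) {G₀ : X → Y} (hG₀ : Measurable G₀)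
    {𝒢 : Set (X → Y)} (h𝒢 : ∀ G ∈ 𝒢, Measurable G) {F : ℝ} (hF : 0 < F)
    (h𝒢F : ∀ G ∈ 𝒢, ∀ a ∈ γ.support, ‖G a - G₀ a‖ ≤ F) {σ : ℝ} (hσ : 0 < σ) {n : ℕ} (hn : 1 ≤ n)
    {x : Fin n → Ω → X} {ξ : Fin n → Ω → Y → ℝ} {Ĝ : Ω → X → Y}
    (hx : IsIIDDesign γ P x) (hξ : IsWhiteNoiseModel P x ξ ∨ IsSubGaussianNoiseModel P x ξ)
    (hERM : IsMeasurableERM γ G₀ σ 𝒢 P x ξ Ĝ) {a A δ e : ℝ} (ha0 : 0 < a) (ha2 : a < 2)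
    (hA : 1 ≤ A) (hδ : 0 < δ) (hδ1 : δ ≤ 1)
    (hent : ∀ u, 0 < u → u ≤ δ → supEntropy γ 𝒢 u ≤ ((A * u ^ (-a) : ℝ) : EReal))
    (he : 0 ≤ e) (happrox : ⨅ G ∈ 𝒢, l2DistSq γ G G₀ ≤ ENNReal.ofReal e) :
    meanSquaredError γ G₀ P Ĝ ≤ ENNReal.ofReal
      (24 * e + (24 + riskConstant σ F a) * (δ ^ 2 + A * δ ^ (-a) / n)) := by
  have hn0 : (0 : ℝ) < n := by exact_mod_cast hn
  -- The slack `δ ^ 2` spares the attainment of the infimum and is of the order of the final bound.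
  obtain ⟨Gs, hGs, hGse⟩ : ∃ Gs ∈ 𝒢, l2DistSq γ Gs G₀ ≤ ENNReal.ofReal (e + δ ^ 2) := by
    have : ⨅ G ∈ 𝒢, l2DistSq γ G G₀ < ENNReal.ofReal (e + δ ^ 2) :=
      happrox.trans_lt ((ENNReal.ofReal_lt_ofReal_iff (by positivity)).2 (by
        have : 0 < δ ^ 2 := by positivity
        linarith))
    simp only [iInf_lt_iff] at this
    obtain ⟨Gs, hGs, h⟩ := this
    exact ⟨Gs, hGs, h.le⟩
  have hc := one_le_noiseProxy
  set c := noiseProxy with hcdef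
  set ρ : ℝ := 2 ^ a with hρ
  have hθ : √ρ / 2 < 1 := sqrt_two_rpow_div_two_lt_one ha2
  have hρ1 : 1 ≤ ρ := Real.one_le_rpow (by norm_num) ha0.le
  have hρ4 : ρ ≤ 4 := by
    have : (2 : ℝ) ^ a ≤ 2 ^ (2 : ℝ) := Real.rpow_le_rpow_of_exponent_le (by norm_num) ha2.le
    rw [Real.rpow_two] at this
    linarith
  set B : ℝ := A * δ ^ (-a) with hBdef
  have hB1 : 1 ≤ B := by
    have : 1 ≤ δ ^ (-a) := Real.one_le_rpow_of_pos_of_le_one_of_nonpos hδ hδ1 (by linarith)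
    nlinarith
  let d : ℕ → ℝ := fun k => δ * (1 / 2) ^ k
  have hd0 : ∀ k, 0 < d k := fun k => by positivity
  have hanti : Antitone d := fun i j hij => by
    simp only [d]
    exact mul_le_mul_of_nonneg_left
      (pow_le_pow_of_le_one (by norm_num) (by norm_num) hij) hδ.le
  have hdlim : Tendsto d atTop (𝓝 0) := by
    simpa [d] using (tendsto_pow_atTop_nhds_zero_of_lt_one (r := (1 / 2 : ℝ)) (by norm_num)
      (by norm_num)).const_mul δ
  have hdδ : ∀ k, d k ≤ δ := fun k => by simpa [d] using hanti (Nat.zero_le k)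
  have hnet := fun k => exists_finset_net_of_supEntropy_le (hd0 k) (hent (d k) (hd0 k) (hdδ k))
  choose T hT𝒢 hTcard hTnet using hnet
  have hdent : ∀ k, A * d k ^ (-a) = B * ρ ^ k := fun k => by
    simp only [d]
    rw [dyadic_rpow_neg hδ, hBdef, mul_assoc]
  simp only [hdent] at hTcard
  -- Two consecutive nets have total log-cardinality at most `B * ρ ^ k * (1 + ρ)`, and `ρ ≤ 4`.
  let h : ℕ → ℝ := fun k => 5 * B * ρ ^ k
  have hh : ∀ k, 0 ≤ h k := fun k => by positivity
  have hcard : ∀ k, ((T k).card * (T (k + 1)).card : ℝ) ≤ Real.exp (h k) := fun k => by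
    calc ((T k).card * (T (k + 1)).card : ℝ) ≤ Real.exp (B * ρ ^ k) * Real.exp (B * ρ ^ (k + 1)) :=
          mul_le_mul (hTcard k) (hTcard (k + 1)) (Nat.cast_nonneg _) (Real.exp_pos _).le
      _ = Real.exp (B * ρ ^ k * (1 + ρ)) := by rw [← Real.exp_add, pow_succ]; congr 1; ring
      _ ≤ Real.exp (h k) := by
          refine Real.exp_le_exp.2 ?_
          have : 0 ≤ B * ρ ^ k := by positivity
          simp only [h]
          nlinarith
  have hcard₀ : ((T 0).card : ℝ) ≤ Real.exp (h 0) :=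
    (hTcard 0).trans (Real.exp_le_exp.2 (by simp only [h, pow_zero]; linarith))
  have hsupp := hx.ae_mem_support hγ
  have hsub : IsSubGaussianNoise P x ξ := hξ.elim
    (fun H => H.isSubGaussianNoise hx.measurable) (fun H => H.isSubGaussianNoise hx.measurable)
  have hcont : IsChainContinuousNoise γ P x ξ T d := hξ.elim
    (fun H => H.isChainContinuousNoise hx.measurable hsupp T (fun k g hg => h𝒢 g (hT𝒢 k hg))
      hdlim hd0 hanti hh hcard
      (summable_dyadic_mul_sqrt hδ (by positivity) (by positivity) hθ))
    (fun H => H.isChainContinuousNoise hsupp T hdlim)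
  -- Up to constants this balances `(lam k)⁻¹ * h k` against `lam k * n * d k ^ 2`.
  let lam : ℕ → ℝ := fun k => √(B * ρ ^ k) / (√n * d k)
  have hlam : ∀ k, 0 < lam k := fun k => by
    have := hd0 k
    positivity
  have hmain := meanSquaredError_le_of_chain hγ hG₀ h𝒢 hF h𝒢F hσ hn hx hsub hT𝒢 hTnet hanti
    hcard₀ hcard hcont hlam hERM hGs
  -- summing the chain
  set θ : ℝ := √ρ / 2 with hθdef
  have hθ0 : 0 ≤ θ := by positivity
  have hsq : ∀ k, √(B * ρ ^ k) * d k = √B * δ * θ ^ k := fun k => by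
    have : √(ρ ^ k) = √ρ ^ k := by
      rw [Real.sqrt_eq_iff_mul_self_eq (by positivity) (by positivity), ← mul_pow,
        Real.mul_self_sqrt (by positivity)]
    rw [Real.sqrt_mul (by positivity), this]
    simp only [d, hθdef, div_pow, one_pow]
    ring
  have hterm : ∀ k, ENNReal.ofReal (lam k)⁻¹ * (ENNReal.ofReal (h k) + 1) +
      ENNReal.ofReal (4 * c * lam k * n * d k ^ 2) ≤
      ENNReal.ofReal ((6 + 4 * c) * (√n * √B * δ) * θ ^ k) := fun k => by
    have hl := hlam k
    have hd := hd0 k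
    have hs : 0 < √(B * ρ ^ k) := by positivity
    have hs2 : √(B * ρ ^ k) ^ 2 = B * ρ ^ k := Real.sq_sqrt (by positivity)
    have hn2 : √(n : ℝ) ^ 2 = n := Real.sq_sqrt hn0.le
    rw [← ENNReal.ofReal_one, ← ENNReal.ofReal_add (hh k) zero_le_one,
      ← ENNReal.ofReal_mul (by positivity), ← ENNReal.ofReal_add
        (mul_nonneg (by positivity) (by linarith [hh k])) (by positivity)]
    refine ENNReal.ofReal_le_ofReal ?_
    have e1 : (lam k)⁻¹ * (6 * (B * ρ ^ k)) = 6 * √n * (√(B * ρ ^ k) * d k) := by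
      have : 6 * (B * ρ ^ k) = 6 * √(B * ρ ^ k) ^ 2 := by rw [hs2]
      rw [this]
      simp only [lam]
      field_simp
    have e2 : 4 * c * lam k * n * d k ^ 2 = 4 * c * √n * (√(B * ρ ^ k) * d k) := by
      simp only [lam]
      have : 0 < √(n : ℝ) := by positivity
      field_simp
      rw [hn2]
    have h1 : h k + 1 ≤ 6 * (B * ρ ^ k) := by
      have : 1 ≤ B * ρ ^ k := one_le_mul_of_one_le_of_one_le hB1 (one_le_pow₀ hρ1)
      simp only [h]
      linarith
    have h2 := mul_le_mul_of_nonneg_left h1 (inv_pos.2 hl).le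
    rw [e1] at h2
    rw [e2]
    rw [hsq k] at h2 ⊢
    linarith
  have hgeo := (hasSum_geometric_of_lt_one hθ0 hθ).mul_left ((6 + 4 * c) * (√n * √B * δ))
  have htsum : ∑' k, (ENNReal.ofReal (lam k)⁻¹ * (ENNReal.ofReal (h k) + 1) +
      ENNReal.ofReal (4 * c * lam k * n * d k ^ 2)) ≤
      ENNReal.ofReal ((6 + 4 * c) * (√n * √B * δ) * (1 - θ)⁻¹) := by
    refine (ENNReal.tsum_le_tsum hterm).trans ?_
    rw [← ENNReal.ofReal_tsum_of_nonneg (fun k => by positivity) hgeo.summable, hgeo.tsum_eq]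
  -- The geometric mean of `n * δ ^ 2` and `B`: the chain costs no more than the two terms already
  -- present.
  have hamgm : √n * √B * δ ≤ (n * δ ^ 2 + B) / 2 := by
    have h1 : √(n : ℝ) ^ 2 = n := Real.sq_sqrt hn0.le
    have h2 : √B ^ 2 = B := Real.sq_sqrt (by positivity)
    nlinarith [sq_nonneg (√n * δ - √B)]
  -- collecting the terms
  have hfinal : ENNReal.ofReal n * meanSquaredError γ G₀ P Ĝ ≤ ENNReal.ofReal
      (n * (24 * e + (24 + riskConstant σ F a) * (δ ^ 2 + B / n))) := by
    refine hmain.trans ?_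
    have hθi : 0 < (1 - θ)⁻¹ := inv_pos.2 (by linarith)
    have hd00 : d 0 = δ := by simp [d]
    have hh0 : ENNReal.ofReal (h 0) + 1 ≤ ENNReal.ofReal (6 * B) := by
      rw [← ENNReal.ofReal_one, ← ENNReal.ofReal_add (hh 0) zero_le_one]
      refine ENNReal.ofReal_le_ofReal ?_
      simp only [h, pow_zero]
      linarith
    calc _ ≤ ENNReal.ofReal 24 * (ENNReal.ofReal n * ENNReal.ofReal (e + δ ^ 2)) +
          ENNReal.ofReal (18 * n * δ ^ 2) +
          ENNReal.ofReal (384 * σ ^ 2 * c) * ENNReal.ofReal (6 * B) +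
          ENNReal.ofReal (32 * σ) *
            ENNReal.ofReal ((6 + 4 * c) * (√n * √B * δ) * (1 - θ)⁻¹) +
          ENNReal.ofReal (4 * F ^ 2) * ENNReal.ofReal (6 * B) := by
          rw [hd00, ENNReal.ofReal_natCast]
          gcongr
      _ = ENNReal.ofReal (24 * (n * (e + δ ^ 2)) + 18 * n * δ ^ 2 + 384 * σ ^ 2 * c * (6 * B) +
          32 * σ * ((6 + 4 * c) * (√n * √B * δ) * (1 - θ)⁻¹) + 4 * F ^ 2 * (6 * B)) := by
          rw [← ENNReal.ofReal_mul (by positivity), ← ENNReal.ofReal_mul (by positivity),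
            ← ENNReal.ofReal_mul (by positivity), ← ENNReal.ofReal_mul (by positivity),
            ← ENNReal.ofReal_mul (by positivity), ← ENNReal.ofReal_add (by positivity)
            (by positivity), ← ENNReal.ofReal_add (by positivity) (by positivity),
            ← ENNReal.ofReal_add (by positivity) (by positivity),
            ← ENNReal.ofReal_add (by positivity) (by positivity)]
      _ ≤ _ := by
          refine ENNReal.ofReal_le_ofReal ?_
          have h1 : n * (24 * e + (24 + riskConstant σ F a) * (δ ^ 2 + B / n)) =
              24 * (n * e) + (24 + riskConstant σ F a) * (n * δ ^ 2 + B) := by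
            field_simp
          have h2 : 32 * σ * ((6 + 4 * c) * (√n * √B * δ) * (1 - θ)⁻¹) ≤
              16 * σ * ((6 + 4 * c) * (1 - θ)⁻¹) * (n * δ ^ 2 + B) := by
            have h3 : 0 ≤ 32 * σ * ((6 + 4 * c) * (1 - θ)⁻¹) := by positivity
            have := mul_le_mul_of_nonneg_left hamgm h3
            linarith
          rw [h1, riskConstant, ← hcdef, ← hρ, ← hθdef]
          have h4 : 0 ≤ n * δ ^ 2 := by positivity
          have h5 : 0 ≤ 384 * σ ^ 2 * c * 6 * (n * δ ^ 2) := by positivity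
          have h6 : 0 ≤ F ^ 2 * (n * δ ^ 2) := by positivity
          linarith
  rw [ENNReal.ofReal_mul hn0.le] at hfinal
  exact (ENNReal.mul_le_mul_iff_right (ENNReal.ofReal_pos.2 hn0).ne' ENNReal.ofReal_ne_top).1 hfinal

end EntropyRate

section Rates

theorem rpow_neg_sq_of_pos {δ₀ m s : ℝ} (hm : 0 < m) :
    (δ₀ * m ^ (-(s / 2))) ^ 2 = δ₀ ^ 2 * m ^ (-s) := by
  rw [mul_pow, ← Real.rpow_natCast (m ^ (-(s / 2))), ← Real.rpow_mul hm.le]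
  congr 2
  push_cast
  ring

theorem mul_rpow_neg_rpow_neg {δ₀ m s a : ℝ} (hδ₀ : 0 < δ₀) (hm : 0 < m) :
    (δ₀ * m ^ (-(s / 2))) ^ (-a) = δ₀ ^ (-a) * m ^ (s * a / 2) := by
  rw [Real.mul_rpow hδ₀.le (by positivity), ← Real.rpow_mul hm.le]
  congr 2
  ring

end Rates

/-! ### The two convergence rates -/

theorem mainTheorem7
    {X Y : Type*}
    [NormedAddCommGroup X] [InnerProductSpace ℝ X] [CompleteSpace X]
    [TopologicalSpace.SeparableSpace X] [MeasurableSpace X] [BorelSpace X]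
    [NormedAddCommGroup Y] [InnerProductSpace ℝ Y] [CompleteSpace Y]
    [TopologicalSpace.SeparableSpace Y] [MeasurableSpace Y] [BorelSpace Y]
    (γ : Measure X) [IsProbabilityMeasure γ]
    (G₀ : X → Y) (hG₀ : Measurable G₀)
    (hG₀_bdd : ∃ B : ℝ, ∀ x ∈ γ.support, ‖G₀ x‖ ≤ B)
    (σ : ℝ) (hσ : 0 < σ)
    -- the regression classes `𝒢 N`, `N = 1, 2, …`
    (𝒢 : ℕ → Set (X → Y))
    (h𝒢_meas : ∀ N, 1 ≤ N → ∀ G ∈ 𝒢 N, Measurable G)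
    (h𝒢_compact : ∀ N, 1 ≤ N → IsCompact (supRestrict γ '' 𝒢 N))
    (h𝒢_bdd : ∃ F : ℝ, ∀ N, 1 ≤ N → ∀ G ∈ 𝒢 N, ∀ x ∈ γ.support, ‖G x - G₀ x‖ ≤ F)
    -- approximation error `≲ N ^ (-β)`
    (β : ℝ) (hβ : 0 < β)
    (h_approx : ∃ c : ℝ, ∀ N : ℕ, 1 ≤ N →
      ⨅ G ∈ 𝒢 N, l2DistSq γ G G₀ ≤ ENNReal.ofReal (c * (N : ℝ) ^ (-β))) :
    -- part (i)
    (∀ α : ℝ, 0 < α → α < 2 →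
      (∃ c δ₀ : ℝ, 0 < δ₀ ∧ δ₀ < 1 ∧ ∀ N : ℕ, 1 ≤ N → ∀ δ : ℝ, 0 < δ → δ ≤ δ₀ →
        supEntropy γ (𝒢 N) δ ≤ ((c * δ ^ (-α) : ℝ) : EReal)) →
      ∃ C : ℝ, 0 < C ∧ ∀ n : ℕ, 1 ≤ n →
        ∀ N : ℕ, 1 ≤ N → (N : ℝ) ^ (-β) ≤ (n : ℝ) ^ (-(2 / (2 + α))) →
        ∀ (Ω : Type*) [MeasurableSpace Ω] (P : Measure Ω) [IsProbabilityMeasure P]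
          (x : Fin n → Ω → X) (ξ : Fin n → Ω → Y → ℝ) (Ĝ : Ω → X → Y),
          IsIIDDesign γ P x →
          (IsWhiteNoiseModel P x ξ ∨ IsSubGaussianNoiseModel P x ξ) →
          IsMeasurableERM γ G₀ σ (𝒢 N) P x ξ Ĝ →
          meanSquaredError γ G₀ P Ĝ ≤ ENNReal.ofReal (C * (n : ℝ) ^ (-(2 / (2 + α))))) ∧
    -- part (ii)
    ((∃ c δ₀ : ℝ, 0 < δ₀ ∧ δ₀ < 1 ∧ ∀ N : ℕ, 1 ≤ N → ∀ δ : ℝ, 0 < δ → δ ≤ δ₀ →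
        supEntropy γ (𝒢 N) δ ≤ ((c * (N : ℝ) * Real.log δ⁻¹ : ℝ) : EReal)) →
      ∀ τ : ℝ, 0 < τ →
      ∃ C : ℝ, 0 < C ∧ ∀ n : ℕ, 1 ≤ n →
        ∀ N : ℕ, N = ⌈(n : ℝ) ^ (1 / (β + 1))⌉₊ →
        ∀ (Ω : Type*) [MeasurableSpace Ω] (P : Measure Ω) [IsProbabilityMeasure P]
          (x : Fin n → Ω → X) (ξ : Fin n → Ω → Y → ℝ) (Ĝ : Ω → X → Y),
          IsIIDDesign γ P x →
          (IsWhiteNoiseModel P x ξ ∨ IsSubGaussianNoiseModel P x ξ) →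
          IsMeasurableERM γ G₀ σ (𝒢 N) P x ξ Ĝ →
          meanSquaredError γ G₀ P Ĝ ≤
            ENNReal.ofReal (C * (n : ℝ) ^ (-(β / (β + 1)) + τ))) := by
  -- Separability makes the support carry full mass, so bounds on the support hold at almost every
  -- design point.
  have hγ : γ.support ∈ ae γ := by
    have := UniformSpace.secondCountable_of_separable X
    exact Measure.support_mem_ae
  have := UniformSpace.secondCountable_of_separable Y
  obtain ⟨F₁, hF₁⟩ := h𝒢_bdd
  obtain ⟨c₁, hc₁⟩ := h_approx
  set F : ℝ := max F₁ 1 with hFdef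
  have hF : 0 < F := lt_of_lt_of_le one_pos (le_max_right _ _)
  have h𝒢F : ∀ N, 1 ≤ N → ∀ G ∈ 𝒢 N, ∀ a ∈ γ.support, ‖G a - G₀ a‖ ≤ F :=
    fun N hN G hG a ha => (hF₁ N hN G hG a ha).trans (le_max_left _ _)
  set c₂ : ℝ := max c₁ 0 with hc₂def
  have hc₂ : 0 ≤ c₂ := le_max_right _ _
  have happrox : ∀ (N : ℕ) (r : ℝ), 1 ≤ N → (N : ℝ) ^ (-β) ≤ r →
      ⨅ G ∈ 𝒢 N, l2DistSq γ G G₀ ≤ ENNReal.ofReal (c₂ * r) := fun N r hN hr =>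
    (hc₁ N hN).trans (ENNReal.ofReal_le_ofReal (mul_le_mul (le_max_left _ _) hr
      (by positivity) hc₂))
  refine ⟨?_, ?_⟩
  · rintro α hα0 hα2 ⟨c, δ₀, hδ₀, hδ₁, hent⟩
    set A : ℝ := max c 1 with hA
    have hA1 : 1 ≤ A := le_max_right _ _
    have hR := riskConstant_pos (F := F) hσ hα2
    refine ⟨24 * c₂ + (24 + riskConstant σ F α) * (1 + A * δ₀ ^ (-α)), by positivity, ?_⟩
    intro n hn N hN hNn Ω _ P _ x ξ Ĝ hx hξ hERM
    have hn1 : (1 : ℝ) ≤ n := by exact_mod_cast hn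
    have hn0 : (0 : ℝ) < n := by linarith
    set s : ℝ := 2 / (2 + α) with hs
    have hs0 : 0 < s := by positivity
    -- Up to constants this solves δ² = δ^(-α) / n; the factor `δ₀` keeps δ within the range of the
    -- entropy hypothesis.
    set δ : ℝ := δ₀ * (n : ℝ) ^ (-(s / 2)) with hδdef
    have hδ : 0 < δ := by positivity
    have hδle : δ ≤ δ₀ := mul_le_of_le_one_right hδ₀.le
      (Real.rpow_le_one_of_one_le_of_nonpos hn1 (by linarith))
    have hmain := meanSquaredError_le_of_entropy hγ hG₀ (h𝒢_meas N hN) hF (h𝒢F N hN) hσ hn hx hξ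
      hERM (e := c₂ * (n : ℝ) ^ (-s)) hα0 hα2 hA1 hδ (hδle.trans hδ₁.le)
      (fun u hu huδ => (hent N hN u hu (huδ.trans hδle)).trans (by
        rw [EReal.coe_le_coe_iff]
        gcongr
        exact le_max_left _ _))
      (by positivity) (happrox N _ hN hNn)
    refine hmain.trans (ENNReal.ofReal_le_ofReal ?_)
    have h1 : δ ^ 2 ≤ (n : ℝ) ^ (-s) := by
      rw [hδdef, rpow_neg_sq_of_pos hn0]
      exact mul_le_of_le_one_left (by positivity) (pow_le_one₀ hδ₀.le hδ₁.le)
    have h2 : A * δ ^ (-α) / n = A * δ₀ ^ (-α) * (n : ℝ) ^ (-s) := by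
      rw [hδdef, mul_rpow_neg_rpow_neg hδ₀ hn0, ← mul_assoc, mul_div_assoc]
      congr 1
      rw [div_eq_iff hn0.ne', ← Real.rpow_add_one hn0.ne']
      congr 1
      rw [hs]
      field_simp
      ring
    rw [h2]
    have h3 : δ ^ 2 + A * δ₀ ^ (-α) * (n : ℝ) ^ (-s) ≤ (1 + A * δ₀ ^ (-α)) * (n : ℝ) ^ (-s) := by
      linarith
    have := mul_le_mul_of_nonneg_left h3 (by positivity : 0 ≤ 24 + riskConstant σ F α)
    linarith
  · rintro ⟨c, δ₀, hδ₀, hδ₁, hent⟩ τ hτ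
    -- Exponent of the polynomial majorant of the logarithm. It costs a factor `n ^ (s * a / 2)`,
    -- which is at most `n ^ τ` because `s ≤ 1`.
    set a : ℝ := min 1 (2 * τ) with ha
    have ha0 : 0 < a := lt_min one_pos (by positivity)
    have ha1 : a ≤ 1 := min_le_left _ _
    have haτ : a ≤ 2 * τ := min_le_right _ _
    have ha2 : a < 2 := by linarith
    set A : ℝ := max c 1 with hA
    have hA1 : 1 ≤ A := le_max_right _ _
    have hR := riskConstant_pos (F := F) hσ ha2
    refine ⟨24 * c₂ + (24 + riskConstant σ F a) * (1 + 2 * (A / a) * δ₀ ^ (-a)),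
      by positivity, ?_⟩
    intro n hn N hNdef Ω _ P _ x ξ Ĝ hx hξ hERM
    have hn1 : (1 : ℝ) ≤ n := by exact_mod_cast hn
    have hn0 : (0 : ℝ) < n := by linarith
    set t : ℝ := 1 / (β + 1) with ht
    set s : ℝ := β / (β + 1) with hs
    have hs0 : 0 < s := by positivity
    have hs1 : s ≤ 1 := (div_le_one (by positivity)).2 (by linarith)
    have hts : t - 1 = -s := by rw [ht, hs]; field_simp; ring
    have hnt : 1 ≤ (n : ℝ) ^ t := Real.one_le_rpow hn1 (by positivity)
    have hNlow : (n : ℝ) ^ t ≤ N := hNdef ▸ Nat.le_ceil _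
    -- Rounding up at most doubles, since `n ^ t ≥ 1`.
    have hNup : (N : ℝ) ≤ 2 * (n : ℝ) ^ t := by
      have := Nat.ceil_lt_add_one (zero_le_one.trans hnt)
      rw [← hNdef] at this
      linarith
    have hN1 : (1 : ℝ) ≤ N := hnt.trans hNlow
    have hN : 1 ≤ N := by exact_mod_cast hN1
    have hNs : (N : ℝ) ^ (-β) ≤ (n : ℝ) ^ (-s) := by
      calc (N : ℝ) ^ (-β) ≤ ((n : ℝ) ^ t) ^ (-β) :=
            Real.rpow_le_rpow_of_nonpos (by positivity) hNlow (by linarith)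
        _ = (n : ℝ) ^ (-s) := by
            rw [← Real.rpow_mul hn0.le]; congr 1; rw [ht, hs]; ring
    have hrate : (n : ℝ) ^ (-s) ≤ (n : ℝ) ^ (-s + τ) :=
      Real.rpow_le_rpow_of_exponent_le hn1 (by linarith)
    set δ : ℝ := δ₀ * (n : ℝ) ^ (-(s / 2)) with hδdef
    have hδ : 0 < δ := by positivity
    have hδle : δ ≤ δ₀ := mul_le_of_le_one_right hδ₀.le
      (Real.rpow_le_one_of_one_le_of_nonpos hn1 (by linarith))
    have hAN : 1 ≤ A * N / a := (one_le_div ha0).2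
      (ha1.trans (one_le_mul_of_one_le_of_one_le hA1 hN1))
    have hmain := meanSquaredError_le_of_entropy hγ hG₀ (h𝒢_meas N hN) hF (h𝒢F N hN) hσ hn hx hξ
      hERM (e := c₂ * (n : ℝ) ^ (-s)) ha0 ha2 hAN hδ (hδle.trans hδ₁.le)
      (fun u hu huδ => (hent N hN u hu (huδ.trans hδle)).trans (by
        rw [EReal.coe_le_coe_iff]
        have hu1 : 1 ≤ u⁻¹ := (one_le_inv₀ hu).2 (huδ.trans (hδle.trans hδ₁.le))
        -- Logarithmic entropy becomes polynomial with exponent `a` and amplitude `A * N / a`; only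
        -- the amplitude depends on `N`.
        have h1 := Real.log_le_rpow_div (zero_le_one.trans hu1) ha0
        rw [Real.inv_rpow hu.le, ← Real.rpow_neg hu.le] at h1
        have h2 := Real.log_nonneg hu1
        calc c * N * Real.log u⁻¹ ≤ A * N * Real.log u⁻¹ := by
              gcongr
              exact le_max_left _ _
          _ ≤ A * N * (u ^ (-a) / a) := by gcongr
          _ = A * N / a * u ^ (-a) := by ring))
      (by positivity) (happrox N _ hN hNs)
    refine hmain.trans (ENNReal.ofReal_le_ofReal ?_)
    have h1 : δ ^ 2 ≤ (n : ℝ) ^ (-s) := by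
      rw [hδdef, rpow_neg_sq_of_pos hn0]
      exact mul_le_of_le_one_left (by positivity) (pow_le_one₀ hδ₀.le hδ₁.le)
    have h2 : A * N / a * δ ^ (-a) / n ≤ 2 * (A / a) * δ₀ ^ (-a) * (n : ℝ) ^ (-s + τ) := by
      rw [hδdef, mul_rpow_neg_rpow_neg hδ₀ hn0]
      have h4 : (N : ℝ) * (n : ℝ) ^ (s * a / 2) / n ≤ 2 * (n : ℝ) ^ (-s + τ) := by
        calc (N : ℝ) * (n : ℝ) ^ (s * a / 2) / n ≤ 2 * (n : ℝ) ^ t * (n : ℝ) ^ (s * a / 2) / n := by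
              gcongr
          _ = 2 * (n : ℝ) ^ (-s + s * a / 2) := by
              rw [mul_assoc, mul_div_assoc, ← Real.rpow_add hn0, ← hts]
              congr 1
              rw [div_eq_iff hn0.ne', ← Real.rpow_add_one hn0.ne']
              congr 1
              ring
          _ ≤ _ := by
              gcongr
              nlinarith
      have h5 := mul_le_mul_of_nonneg_left h4 (by positivity : 0 ≤ A / a * δ₀ ^ (-a))
      refine le_trans (le_of_eq ?_) (h5.trans (le_of_eq ?_)) <;> ring
    have h3 : δ ^ 2 + A * N / a * δ ^ (-a) / n ≤
        (1 + 2 * (A / a) * δ₀ ^ (-a)) * (n : ℝ) ^ (-s + τ) := by linarith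
    have h4 := mul_le_mul_of_nonneg_left h3 (by positivity : 0 ≤ 24 + riskConstant σ F a)
    have h5 := mul_le_mul_of_nonneg_left hrate hc₂
    linarith
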